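/- **Definitions.** A *coherent configuration* on a finite set $\Omega$ is a partition $S$ of $\Omega\times\Omega$ (into *basis relations*) such that the diagonal $1_\Omega$ is a union of members of $S$, the transpose $s^*$ of every $s\in S$ is in $S$, and for all $r,s,t\in S$ the number $c_{rs}^t=|\{\gamma\in\Omega:(\alpha,\gamma)\in r,\ (\gamma,\beta)\in s\}|$ is the same for all $(\alpha,\beta)\in t$. It is a *scheme* if $1_\Omega\in S$. A basis relation is *irreflexive* if it is disjoint from $1_\Omega$. For $s,t\in S$ put $n_s=|\{\gamma:(\alpha,\gamma)\in s\}|$ (for any $\alpha$ in the domain of $s$), $c(s)=\sum_{r\in S}c_{rr^*}^s$ and $m_t=\max_{r,s\in S}c_{rs}^t$. A scheme is *pseudocyclic of valency $k$* if $c(s)+1=k=n_s$ for every irreflexive $s\in S$. An *algebraic automorphism* of $\mathcal X=(\Omega,S)$ is a permutation $\varphi$ of $S$ with $c_{\varphi(r)\varphi(s)}^{\varphi(t)}=c_{rs}^t$ for all $r,s,t\in S$. For a group $\Phi$ of algebraic automorphisms, the *algebraic fusion* is $\mathcal X^\Phi=(\Omega,\{s^\Phi:s\in S\})$, where $s^\Phi=\bigcup_{\varphi\in\Phi}\varphi(s)$.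 For a group $G$ acting on $\Omega$, $\mathrm{Inv}(G,\Omega)$ is the coherent configuration whose basis relations are the orbits of $G$ on $\Omega\times\Omega$. **Proposition 5.2.** Let $d\ge 3$ be a prime and $q=2^d$. Let $\mathrm{P\Gamma L}(2,q)$ act faithfully and transitively on a set $\Omega$ with $|\Omega|=q(q-1)/2$. Let $\mathcal X=\mathrm{Inv}(\mathrm{P\Gamma L}(2,q),\Omega)$ (the *small Hollmann scheme*) and $\mathcal X_q=\mathrm{Inv}(\mathrm{PSL}(2,q),\Omega)$ (the *large Hollmann scheme*), where $\mathrm{PSL}(2,q)\le\mathrm{P\Gamma L}(2,q)$ acts by restriction. Then 1. $\mathcal X=(\mathcal X_q)^\Phi$ for some group $\Phi$ of algebraic automorphisms of $\mathcal X_q$ with $|\Phi|=d$; 2. $\mathcal X$ is a pseudocyclic scheme of valency $d(q+1)$; 3. $m_t\le 4d^2$ for each irreflexive basis relation $t$ of $\mathcal X$. -/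

import Mathlib

open scoped LinearAlgebra.Projectivization

/-- A coherent configuration on a finite set `Ω`: a partition `rels` of `Ω × Ω` into basis
relations such that the diagonal is a union of basis relations, the transpose of a basis relation
is a basis relation, and for basis relations `r, s, t` the number of `γ` with `(α, γ) ∈ r` and
`(γ, β) ∈ s` is the same for all `(α, β) ∈ t`. -/
structure CoherentConfiguration (Ω : Type*) [Finite Ω] where
  rels : Set (Set (Ω × Ω))
  isPartition : Setoid.IsPartition rels
  diag_mem : ∃ T ⊆ rels, ⋃₀ T = Set.diagonal Ω
  swap_mem : ∀ s ∈ rels, Prod.swap ⁻¹' s ∈ rels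
  coherent : ∀ r ∈ rels, ∀ s ∈ rels, ∀ t ∈ rels, ∀ p ∈ t, ∀ p' ∈ t,
    {γ : Ω | (p.1, γ) ∈ r ∧ (γ, p.2) ∈ s}.ncard = {γ : Ω | (p'.1, γ) ∈ r ∧ (γ, p'.2) ∈ s}.ncard

namespace CoherentConfiguration

variable {Ω : Type*} [Finite Ω] (X : CoherentConfiguration Ω)

/-- The type of basis relations. -/
abbrev BasisRel : Type _ := ↥X.rels

variable {X} in
theorem basisRel_nonempty (t : X.BasisRel) : (t : Set (Ω × Ω)).Nonempty :=
  Setoid.nonempty_of_mem_partition X.isPartition t.2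

/-- A pair of points chosen in a basis relation. -/
noncomputable def rep (t : X.BasisRel) : Ω × Ω := (basisRel_nonempty t).choose

theorem rep_mem (t : X.BasisRel) : X.rep t ∈ (t : Set (Ω × Ω)) := (basisRel_nonempty t).choose_spec

/-- The transpose `s*` of a basis relation. -/
def star (s : X.BasisRel) : X.BasisRel := ⟨Prod.swap ⁻¹' (s : Set (Ω × Ω)), X.swap_mem s s.2⟩

/-- The intersection number `c_{rs}^t`. -/
noncomputable def interNum (r s t : X.BasisRel) : ℕ :=
  {γ : Ω | ((X.rep t).1, γ) ∈ (r : Set (Ω × Ω)) ∧ (γ, (X.rep t).2) ∈ (s : Set (Ω × Ω))}.ncard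

/-- The intersection number does not depend on the chosen pair. -/
theorem interNum_eq (r s t : X.BasisRel) {α β : Ω} (h : (α, β) ∈ (t : Set (Ω × Ω))) :
    X.interNum r s t =
      {γ : Ω | (α, γ) ∈ (r : Set (Ω × Ω)) ∧ (γ, β) ∈ (s : Set (Ω × Ω))}.ncard :=
  X.coherent r r.2 s s.2 t t.2 _ (X.rep_mem t) _ h

/-- The valency `n_s` of a basis relation: the number of points `γ` with `(α, γ) ∈ s`, for any
point `α` in the domain of `s`. -/
noncomputable def valency (s : X.BasisRel) : ℕ :=
  {γ : Ω | ((X.rep s).1, γ) ∈ (s : Set (Ω × Ω))}.ncard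

/-- The valency does not depend on the chosen point. -/
theorem valency_eq (s : X.BasisRel) {α β : Ω} (h : (α, β) ∈ (s : Set (Ω × Ω))) :
    X.valency s = {γ : Ω | (α, γ) ∈ (s : Set (Ω × Ω))}.ncard := by
  obtain ⟨T, hT, hTd⟩ := X.diag_mem
  obtain ⟨r, hrT, hr⟩ : ((α, α) : Ω × Ω) ∈ ⋃₀ T := by rw [hTd]; rfl
  have hrd : ∀ p ∈ r, p.1 = p.2 := fun p hp => by
    have : p ∈ Set.diagonal Ω := by rw [← hTd]; exact ⟨r, hrT, hp⟩
    exact this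
  have key := X.coherent r (hT hrT) s s.2 s s.2 _ h _ (X.rep_mem s)
  have hne : {γ : Ω | (α, γ) ∈ r ∧ (γ, β) ∈ (s : Set (Ω × Ω))}.ncard ≠ 0 :=
    Set.ncard_ne_zero_of_mem (a := α) ⟨hr, h⟩
  have hr' : ((X.rep s).1, (X.rep s).1) ∈ r := by
    obtain ⟨γ, h1, -⟩ := Set.nonempty_of_ncard_ne_zero (key ▸ hne)
    have h2 : (X.rep s).1 = γ := hrd _ h1
    rwa [← h2] at h1
  have := X.coherent s s.2 _ (X.swap_mem s s.2) r (hT hrT) _ hr' _ hr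
  simpa [valency] using this

/-- A basis relation is irreflexive if it is disjoint from the diagonal. -/
def IsIrreflexive (s : X.BasisRel) : Prop := ∀ α : Ω, (α, α) ∉ (s : Set (Ω × Ω))

/-- A scheme (homogeneous coherent configuration): the diagonal is a basis relation. -/
def IsScheme : Prop := Set.diagonal Ω ∈ X.rels

/-- The indistinguishing number `c(s)`, the sum of `c_{rr*}^s` over all basis relations `r`. -/
noncomputable def indistNum (s : X.BasisRel) : ℕ := ∑ᶠ r : X.BasisRel, X.interNum r (X.star r) s

/-- A scheme is pseudocyclic of valency `k` if `c(s) + 1 = k = n_s` for all irreflexive `s`. -/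
def IsPseudocyclic (k : ℕ) : Prop :=
  X.IsScheme ∧ ∀ s : X.BasisRel, X.IsIrreflexive s → X.indistNum s + 1 = k ∧ k = X.valency s

/-- The number `m_t`, the maximum of `c_{rs}^t` over all basis relations `r, s`
(a maximum over a finite set). -/
noncomputable def maxInterNum (t : X.BasisRel) : ℕ :=
  ⨆ p : X.BasisRel × X.BasisRel, X.interNum p.1 p.2 t

/-- The group of algebraic automorphisms: permutations of the set of basis relations that preserve
the intersection numbers. -/
def algAut : Subgroup (Equiv.Perm X.BasisRel) where
  carrier := {φ | ∀ r s t, X.interNum (φ r) (φ s) (φ t) = X.interNum r s t}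
  one_mem' := fun _ _ _ => rfl
  mul_mem' := fun {φ ψ} hφ hψ r s t => (hφ _ _ _).trans (hψ r s t)
  inv_mem' := fun {φ} hφ r s t => by
    have := hφ (φ⁻¹ r) (φ⁻¹ s) (φ⁻¹ t)
    simpa using this.symm

/-- The relations `s^Φ = ⋃_{φ ∈ Φ} φ(s)`, for all basis relations `s`: these are the basis
relations of the algebraic fusion of `X` with respect to `Φ`. -/
def fusionRels (Φ : Subgroup (Equiv.Perm X.BasisRel)) : Set (Set (Ω × Ω)) :=
  Set.range fun s : X.BasisRel => ⋃ φ ∈ Φ, (φ s : Set (Ω × Ω))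

end CoherentConfiguration

/-- `X` is the algebraic fusion of `Y` with respect to the group `Φ` of algebraic automorphisms
of `Y`. -/
def IsAlgebraicFusion {Ω : Type*} [Finite Ω] (X Y : CoherentConfiguration Ω)
    (Φ : Subgroup (Equiv.Perm Y.BasisRel)) : Prop :=
  Φ ≤ Y.algAut ∧ X.rels = Y.fusionRels Φ

/-- The coherent configuration `Inv(G, Ω)` of a group `G` acting on a finite set `Ω`: its basis
relations are the orbits of `G` on `Ω × Ω`. -/
def orbitalConfiguration (G : Type*) [Group G] (Ω : Type*) [Finite Ω] [MulAction G Ω] :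
    CoherentConfiguration Ω where
  rels := Set.range fun p : Ω × Ω => MulAction.orbit G p
  isPartition := by
    refine ⟨?_, fun p => ⟨MulAction.orbit G p, ⟨⟨p, rfl⟩, MulAction.mem_orbit_self p⟩, ?_⟩⟩
    · rintro ⟨p, hp⟩
      exact (MulAction.nonempty_orbit p).ne_empty hp
    · rintro _ ⟨⟨p', rfl⟩, h⟩
      exact (MulAction.orbit_eq_iff.mpr h).symm
  diag_mem := by
    refine ⟨Set.range fun α : Ω => MulAction.orbit G (α, α), ?_, ?_⟩
    · rintro _ ⟨α, rfl⟩
      exact ⟨(α, α), rfl⟩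
    · ext ⟨α, β⟩
      constructor
      · rintro ⟨_, ⟨γ, rfl⟩, g, hg⟩
        have := Prod.ext_iff.mp hg
        exact this.1.symm.trans this.2
      · intro h
        obtain rfl : α = β := h
        exact ⟨_, ⟨α, rfl⟩, MulAction.mem_orbit_self _⟩
  swap_mem := by
    rintro _ ⟨⟨α, β⟩, rfl⟩
    refine ⟨(β, α), ?_⟩
    ext ⟨γ, δ⟩
    constructor
    · rintro ⟨g, hg⟩
      exact ⟨g, congrArg Prod.swap hg⟩
    · rintro ⟨g, hg⟩
      exact ⟨g, congrArg Prod.swap hg⟩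
  coherent := by
    rintro _ ⟨r, rfl⟩ _ ⟨s, rfl⟩ _ ⟨t, rfl⟩ p hp p' hp'
    obtain ⟨g, rfl⟩ : ∃ g : G, g • p = p' := by
      have : p' ∈ MulAction.orbit G p := by rwa [MulAction.orbit_eq_iff.mpr hp]
      exact this
    have hmem : ∀ (u : Ω × Ω) (α β : Ω),
        (g • α, g • β) ∈ MulAction.orbit G u ↔ (α, β) ∈ MulAction.orbit G u := fun u α β => by
      rw [← MulAction.orbit_eq_iff, ← MulAction.orbit_eq_iff,
        show (g • α, g • β) = g • (α, β) from rfl, MulAction.orbit_smul]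
    rw [← Set.ncard_image_of_injective _ (MulAction.injective g)]
    congr 1
    ext γ
    constructor
    · rintro ⟨δ, ⟨h1, h2⟩, rfl⟩
      exact ⟨(hmem _ _ _).mpr h1, (hmem _ _ _).mpr h2⟩
    · rintro ⟨h1, h2⟩
      refine ⟨g⁻¹ • γ, ⟨(hmem _ _ _).mp ?_, (hmem _ _ _).mp ?_⟩, smul_inv_smul g γ⟩
      · rwa [smul_inv_smul]
      · rwa [smul_inv_smul]

/-- The group `PΓL(2, F)`, as the group of all permutations of the projective line over `F` that
are induced by invertible semilinear maps of `F²`. -/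
def PGammaL (F : Type*) [Field F] : Subgroup (Equiv.Perm (ℙ F (Fin 2 → F))) where
  carrier := {f | ∃ (σ : F ≃+* F) (g : (Fin 2 → F) ≃+ (Fin 2 → F)),
    (∀ (a : F) (v : Fin 2 → F), g (a • v) = σ a • g v) ∧
    ∀ (v : Fin 2 → F) (hv : v ≠ 0),
      f (Projectivization.mk F v hv) =
        Projectivization.mk F (g v) ((map_ne_zero_iff g g.injective).mpr hv)}
  one_mem' := ⟨RingEquiv.refl F, AddEquiv.refl _, fun _ _ => rfl, fun _ _ => rfl⟩
  mul_mem' := by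
    rintro f f' ⟨σ, g, h1, h2⟩ ⟨σ', g', h1', h2'⟩
    refine ⟨σ'.trans σ, g'.trans g, fun a v => ?_, fun v hv => ?_⟩
    · simp [h1, h1']
    · rw [Equiv.Perm.mul_apply, h2', h2]
      rfl
  inv_mem' := by
    rintro f ⟨σ, g, h1, h2⟩
    refine ⟨σ.symm, g.symm, fun a v => ?_, fun v hv => ?_⟩
    · apply g.injective
      simp [h1]
    · rw [Equiv.Perm.inv_eq_iff_eq, h2]
      simp

/-- The group `PSL(2, F)`, in its action on the projective line, as a subgroup of `PΓL(2, F)`. -/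
def PSLSubgroup (F : Type*) [Field F] : Subgroup (PGammaL F) :=
  (MulAction.toPermHom (Matrix.ProjectiveSpecialLinearGroup (Fin 2) F)
    (ℙ F (Fin 2 → F))).range.subgroupOf (PGammaL F)

/-- `PSL(2, F)` is indeed contained in `PΓL(2, F)`. -/
theorem range_toPermHom_le_PGammaL (F : Type*) [Field F] :
    (MulAction.toPermHom (Matrix.ProjectiveSpecialLinearGroup (Fin 2) F)
      (ℙ F (Fin 2 → F))).range ≤ PGammaL F := by
  rintro _ ⟨A, rfl⟩
  obtain ⟨A, rfl⟩ := QuotientGroup.mk_surjective A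
  exact ⟨RingEquiv.refl F, (Matrix.SpecialLinearGroup.toLin' A).toAddEquiv,
    fun a v => (Matrix.SpecialLinearGroup.toLin' A).map_smul a v, fun v hv => rfl⟩

/-- The small Hollmann scheme: the scheme of the permutation group `PΓL(2, q)` of degree
`q(q - 1)/2`. -/
abbrev smallHollmann (F : Type*) [Field F] (Ω : Type*) [Finite Ω] [MulAction (PGammaL F) Ω] :
    CoherentConfiguration Ω :=
  orbitalConfiguration (PGammaL F) Ω

/-- The large Hollmann scheme on the same points: the scheme of the subgroup `PSL(2, q)`. -/
abbrev largeHollmann (F : Type*) [Field F] (Ω : Type*) [Finite Ω] [MulAction (PGammaL F) Ω] :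
    CoherentConfiguration Ω :=
  orbitalConfiguration (PSLSubgroup F) Ω

/-! Put q = |F| and let B be the standard symplectic form on F². The points are modelled by the
anisotropic quadratic forms on F² with polarization B (`Elliptic F`). SL(2,F) ⋊ Aut(F) acts on them,
and it maps onto PΓL(2,q) because every element of F is a square.

The forms with polarization B make up an affine plane: R = Q + B(v,·)² for a unique vector v, and
inv(Q,R) = Q(v). If Q is anisotropic, then R is so exactly when Q(v) has the form t² + t
(`Aniso.twist_iff`). A Witt-type extension argument (`exists_SL_smul_form`) makes inv a complete
invariant of pairs of points under SL(2,F). Semilinear maps apply their field automorphism to inv.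
So the PSL relations are indexed by the elements t² + t, and the PΓL relations by the Galois orbits
of these. As d is an odd prime, a nontrivial automorphism fixes only 0 and 1, and 1 is not of the
form t² + t; hence Aut(F), of order d, moves every nonzero index (`map_ne_self`). This gives the
fusion with |Φ| = d.

A circle inv(α,·) = e with e ≠ 0 has q + 1 points, and e has d conjugates: this is the valency. For
α ≠ β, the equation inv(β,γ) = σ(inv(α,γ)) has q solutions γ if σ = 1 (two half lines of an affine
plane) and q + 1 if σ ≠ 1 (a fixed point count in a coset of SL(2,F)). The total is q + (d - 1)(q +
1) = d(q + 1) - 1. Circles with distinct centres share at most 4 points, and d² pairs of circles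
bound m_t.

An arbitrary Ω is identified with the model through a point stabilizer, of order 2(q + 1)d. It has a
normal subgroup of odd order (q + 1)d, which fixes a form Q by averaging and contains some A ≠ 1 in
SL(2,F) without eigenvectors. So Q is anisotropic and is the only form fixed by A; normality then
makes the whole stabilizer fix Q. -/

open Matrix

namespace Hollmann

/-! ### The symplectic plane and its semilinear group -/

section Symplectic

variable {F : Type*} [Field F]

/-- The standard symplectic form on `F²`. -/
def symp (x y : Fin 2 → F) : F := x 0 * y 1 - x 1 * y 0

theorem symp_add_right (x y z : Fin 2 → F) : symp x (y + z) = symp x y + symp x z := by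
  simp [symp]; ring

theorem symp_add_left (x y z : Fin 2 → F) : symp (x + y) z = symp x z + symp y z := by
  simp [symp]; ring

theorem symp_smul_right (t : F) (x y : Fin 2 → F) : symp x (t • y) = t * symp x y := by
  simp [symp]; ring

theorem symp_smul_left (t : F) (x y : Fin 2 → F) : symp (t • x) y = t * symp x y := by
  simp [symp]; ring

theorem symp_self (x : Fin 2 → F) : symp x x = 0 := by
  simp [symp]; ring

theorem symp_zero_left (x : Fin 2 → F) : symp 0 x = 0 := by
  simp [symp]

theorem symp_swap (x y : Fin 2 → F) : symp x y = -symp y x := by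
  simp [symp]; ring

theorem SL_smul_zero (A : SpecialLinearGroup (Fin 2) F) (x : Fin 2 → F) :
    (A • x) 0 = A.1 0 0 * x 0 + A.1 0 1 * x 1 := by
  change (A.1 *ᵥ x) 0 = _
  simp [Matrix.mulVec, dotProduct, Fin.sum_univ_two]

theorem SL_smul_one (A : SpecialLinearGroup (Fin 2) F) (x : Fin 2 → F) :
    (A • x) 1 = A.1 1 0 * x 0 + A.1 1 1 * x 1 := by
  change (A.1 *ᵥ x) 1 = _
  simp [Matrix.mulVec, dotProduct, Fin.sum_univ_two]

theorem symp_SL_smul (A : SpecialLinearGroup (Fin 2) F) (x y : Fin 2 → F) :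
    symp (A • x) (A • y) = symp x y := by
  have h : A.1 0 0 * A.1 1 1 - A.1 0 1 * A.1 1 0 = 1 := by
    rw [← Matrix.det_fin_two, A.2]
  simp only [symp, SL_smul_zero, SL_smul_one]
  linear_combination (x 0 * y 1 - x 1 * y 0) * h

/-- Coordinates with respect to a hyperbolic pair. -/
theorem eq_combination {v w : Fin 2 → F} (h : symp v w = 1) (x : Fin 2 → F) :
    x = symp x w • v + symp v x • w := by
  funext i
  fin_cases i <;> simp [symp] at h ⊢
  · linear_combination (-x 0) * h
  · linear_combination (-x 1) * h

theorem exists_symp_eq_one {v : Fin 2 → F} (hv : v ≠ 0) : ∃ w, symp v w = 1 := by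
  by_cases h0 : v 0 = 0
  · have h1 : v 1 ≠ 0 := fun h1 => hv (by funext i; fin_cases i <;> simp [h0, h1])
    exact ⟨![-(v 1)⁻¹, 0], by simp [symp, h1]⟩
  · exact ⟨![0, (v 0)⁻¹], by simp [symp, h0]⟩

theorem eq_of_symp_eq {v w : Fin 2 → F} (h : ∀ x, symp v x = symp w x) : v = w := by
  funext i
  have h0 := h ![1, 0]
  have h1 := h ![0, 1]
  simp [symp] at h0 h1
  fin_cases i <;> simp [h0, h1]

/-- The matrix whose columns form a given hyperbolic pair. -/
def ofPair (v w : Fin 2 → F) (h : symp v w = 1) : SpecialLinearGroup (Fin 2) F :=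
  ⟨!![v 0, w 0; v 1, w 1], by rw [Matrix.det_fin_two_of, ← h, symp]; ring⟩

theorem ofPair_smul (v w : Fin 2 → F) (h : symp v w = 1) (x : Fin 2 → F) :
    ofPair v w h • x = x 0 • v + x 1 • w := by
  funext i
  fin_cases i
  · exact (SL_smul_zero _ _).trans (by simp [ofPair, mul_comm])
  · exact (SL_smul_one _ _).trans (by simp [ofPair]; ring)

/-- `SL(2, F)` is transitive on hyperbolic pairs. -/
theorem exists_SL_smul_eq {v w v' w' : Fin 2 → F} (h : symp v w = 1) (h' : symp v' w' = 1) :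
    ∃ A : SpecialLinearGroup (Fin 2) F, A • v = v' ∧ A • w = w' := by
  refine ⟨ofPair v' w' h' * (ofPair v w h)⁻¹, ?_, ?_⟩
  · rw [mul_smul, show (ofPair v w h)⁻¹ • v = ![1, 0] from ?_]
    · simp [ofPair_smul]
    · rw [inv_smul_eq_iff]; simp [ofPair_smul]
  · rw [mul_smul, show (ofPair v w h)⁻¹ • w = ![0, 1] from ?_]
    · simp [ofPair_smul]
    · rw [inv_smul_eq_iff]; simp [ofPair_smul]

variable (F) in
/-- The action of field automorphisms on `SL(2, F)`. -/
def galAction : (F ≃+* F) →* MulAut (SpecialLinearGroup (Fin 2) F) where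
  toFun σ :=
    { toFun := SpecialLinearGroup.map σ.toRingHom
      invFun := SpecialLinearGroup.map σ.symm.toRingHom
      left_inv := fun A => by ext i j; simp
      right_inv := fun A => by ext i j; simp
      map_mul' := map_mul _ }
  map_one' := by ext A i j; rfl
  map_mul' σ τ := by ext A i j; rfl

variable (F) in
/-- The semilinear group `SL(2, F) ⋊ Aut(F)`. -/
abbrev SemiSL : Type _ := SpecialLinearGroup (Fin 2) F ⋊[galAction F] (F ≃+* F)

theorem galAction_smul (σ : F ≃+* F) (A : SpecialLinearGroup (Fin 2) F) (v : Fin 2 → F) :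
    galAction F σ A • (fun i => σ (v i)) = fun i => σ ((A • v) i) := by
  funext i
  fin_cases i
  · simp [SL_smul_zero, galAction]
  · simp [SL_smul_one, galAction]

instance : DistribMulAction (SemiSL F) (Fin 2 → F) where
  smul s v := s.left • fun i => s.right (v i)
  one_smul v := by
    change (1 : SpecialLinearGroup (Fin 2) F) • v = v
    exact one_smul _ v
  mul_smul s t v := by
    change (s.left * galAction F s.right t.left) • (fun i => s.right (t.right (v i))) =
      s.left • fun i => s.right ((t.left • fun i => t.right (v i)) i)
    rw [mul_smul, ← galAction_smul]
  smul_zero s := by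
    change s.left • (fun i => s.right ((0 : Fin 2 → F) i)) = 0
    have : (fun i => s.right ((0 : Fin 2 → F) i)) = 0 := by funext i; simp
    rw [this, smul_zero]
  smul_add s v w := by
    change s.left • (fun i => s.right ((v + w) i)) =
      s.left • (fun i => s.right (v i)) + s.left • (fun i => s.right (w i))
    rw [← smul_add]
    congr 1
    funext i
    simp

theorem semi_smul_def (s : SemiSL F) (v : Fin 2 → F) :
    s • v = s.left • fun i => s.right (v i) := rfl

theorem semi_smul_smul (s : SemiSL F) (t : F) (v : Fin 2 → F) :
    s • (t • v) = s.right t • s • v := by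
  rw [semi_smul_def, semi_smul_def, ← smul_comm]
  congr 1
  funext i
  simp

theorem symp_semi_smul (s : SemiSL F) (v w : Fin 2 → F) :
    symp (s • v) (s • w) = s.right (symp v w) := by
  rw [semi_smul_def, semi_smul_def, symp_SL_smul]
  simp [symp]

theorem inl_smul (A : SpecialLinearGroup (Fin 2) F) (v : Fin 2 → F) :
    (SemidirectProduct.inl A : SemiSL F) • v = A • v := rfl

end Symplectic

/-! ### The affine plane of forms with given polarization -/

/-- Quadratic forms on `F²` whose polarization is the standard symplectic form. -/
@[ext]
structure PolarForm (F : Type*) [Field F] where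
  toFun : (Fin 2 → F) → F
  map_smul' : ∀ (t : F) x, toFun (t • x) = t ^ 2 * toFun x
  map_add' : ∀ x y, toFun (x + y) = toFun x + toFun y + symp x y

namespace PolarForm

variable {F : Type*} [Field F]

instance : CoeFun (PolarForm F) fun _ => (Fin 2 → F) → F := ⟨toFun⟩

theorem map_smul (Q : PolarForm F) (t : F) (x : Fin 2 → F) : Q (t • x) = t ^ 2 * Q x :=
  Q.map_smul' t x

theorem map_add (Q : PolarForm F) (x y : Fin 2 → F) : Q (x + y) = Q x + Q y + symp x y :=
  Q.map_add' x y

theorem map_zero (Q : PolarForm F) : Q 0 = 0 := by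
  simpa using Q.map_smul 0 0

theorem map_comb (Q : PolarForm F) (s t : F) (v w : Fin 2 → F) :
    Q (s • v + t • w) = s ^ 2 * Q v + t ^ 2 * Q w + s * t * symp v w := by
  rw [map_add, map_smul, map_smul, symp_smul_left, symp_smul_right]; ring

instance : MulAction (SemiSL F) (PolarForm F) where
  smul s Q :=
    { toFun := fun x => s.right (Q (s⁻¹ • x))
      map_smul' := fun t x => by
        rw [semi_smul_smul, map_smul, map_mul, map_pow, SemidirectProduct.inv_right]
        rw [← RingAut.mul_apply, mul_inv_cancel, RingAut.one_apply]
      map_add' := fun x y => by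
        rw [smul_add, map_add, _root_.map_add, _root_.map_add, ← symp_semi_smul,
          smul_inv_smul, smul_inv_smul] }
  one_smul Q := by
    ext x
    change (1 : F ≃+* F) (Q ((1 : SemiSL F)⁻¹ • x)) = Q x
    simp
  mul_smul s t Q := by
    ext x
    change (s * t).right (Q ((s * t)⁻¹ • x)) = s.right (t.right (Q (t⁻¹ • s⁻¹ • x)))
    rw [_root_.mul_inv_rev, mul_smul, SemidirectProduct.mul_right, RingAut.mul_apply]

theorem smul_apply (s : SemiSL F) (Q : PolarForm F) (x : Fin 2 → F) :
    (s • Q) x = s.right (Q (s⁻¹ • x)) := rfl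

theorem smul_apply_smul (s : SemiSL F) (Q : PolarForm F) (x : Fin 2 → F) :
    (s • Q) (s • x) = s.right (Q x) := by
  rw [smul_apply, inv_smul_smul]

theorem eq_of_pair {Q R : PolarForm F} {v w : Fin 2 → F} (h : symp v w = 1) (hv : Q v = R v)
    (hw : Q w = R w) : Q = R := by
  ext x
  rw [eq_combination h x]
  exact (Q.map_comb _ _ v w).trans (by rw [hv, hw]; exact (R.map_comb _ _ v w).symm)

/-- Anisotropic (elliptic) forms. -/
def Aniso (Q : PolarForm F) : Prop := ∀ x, Q x = 0 → x = 0

theorem Aniso.smul {Q : PolarForm F} (hQ : Q.Aniso) (s : SemiSL F) : (s • Q).Aniso := by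
  intro x hx
  rw [smul_apply] at hx
  have := hQ _ ((map_eq_zero s.right).mp hx)
  rwa [smul_eq_zero_iff_eq] at this

variable [CharP F 2]

/-- The form `Q + B(v, ·)²`. -/
def twist (Q : PolarForm F) (v : Fin 2 → F) : PolarForm F where
  toFun x := Q x + symp v x ^ 2
  map_smul' t x := by rw [map_smul, symp_smul_right]; ring
  map_add' x y := by rw [map_add, symp_add_right, CharTwo.add_sq]; ring

theorem twist_apply (Q : PolarForm F) (v x : Fin 2 → F) : Q.twist v x = Q x + symp v x ^ 2 := rfl

theorem twist_apply_self (Q : PolarForm F) (v : Fin 2 → F) : Q.twist v v = Q v := by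
  rw [twist_apply, symp_self]; ring

theorem twist_zero (Q : PolarForm F) : Q.twist 0 = Q := by
  ext x
  change Q x + symp 0 x ^ 2 = Q x
  rw [symp_zero_left]; ring

theorem twist_twist (Q : PolarForm F) (v w : Fin 2 → F) :
    (Q.twist v).twist w = Q.twist (v + w) := by
  ext x
  change Q x + symp v x ^ 2 + symp w x ^ 2 = Q x + symp (v + w) x ^ 2
  rw [symp_add_left, CharTwo.add_sq]; ring

theorem twist_injective (Q : PolarForm F) : Function.Injective Q.twist := by
  intro v w h
  refine eq_of_symp_eq fun x => ?_
  have hx : Q x + symp v x ^ 2 = Q x + symp w x ^ 2 := congrArg (fun R : PolarForm F => R x) h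
  exact CharTwo.sq_inj.mp (add_left_cancel hx)

theorem smul_twist (s : SemiSL F) (Q : PolarForm F) (v : Fin 2 → F) :
    s • Q.twist v = (s • Q).twist (s • v) := by
  ext x
  change s.right (Q (s⁻¹ • x) + symp v (s⁻¹ • x) ^ 2) =
    s.right (Q (s⁻¹ • x)) + symp (s • v) x ^ 2
  rw [_root_.map_add, map_pow, ← symp_semi_smul, smul_inv_smul]

variable [Finite F]

theorem exists_twist_eq (Q R : PolarForm F) : ∃ v, Q.twist v = R := by
  -- Squaring is bijective on F, so v can be chosen to match R - Q on the two basis vectors, and a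
  -- form is determined by its values on a hyperbolic pair.
  have hsq : Function.Surjective fun x : F => x ^ 2 :=
    Finite.injective_iff_surjective.mp fun a b => CharTwo.sq_inj.mp
  obtain ⟨a, ha⟩ := hsq (Q ![1, 0] + R ![1, 0])
  obtain ⟨b, hb⟩ := hsq (Q ![0, 1] + R ![0, 1])
  refine ⟨![b, -a], eq_of_pair (v := ![1, 0]) (w := ![0, 1]) (by simp [symp]) ?_ ?_⟩
  · simp only [twist_apply, symp]
    simp only [cons_val_zero, cons_val_one]
    linear_combination ha + CharTwo.add_self_eq_zero (Q ![1, 0])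
  · simp only [twist_apply, symp]
    simp only [cons_val_zero, cons_val_one]
    linear_combination hb + CharTwo.add_self_eq_zero (Q ![0, 1])

/-- The vector `v` with `R = Q + B(v, ·)²`. -/
noncomputable def disp (Q R : PolarForm F) : Fin 2 → F := (Q.exists_twist_eq R).choose

theorem twist_disp (Q R : PolarForm F) : Q.twist (Q.disp R) = R := (Q.exists_twist_eq R).choose_spec

theorem disp_eq_iff {Q R : PolarForm F} {v : Fin 2 → F} : Q.disp R = v ↔ R = Q.twist v :=
  ⟨fun h => by rw [← h, twist_disp], fun h => Q.twist_injective (by rw [twist_disp, h])⟩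

theorem disp_twist (Q : PolarForm F) (v : Fin 2 → F) : Q.disp (Q.twist v) = v := disp_eq_iff.mpr rfl

theorem disp_swap (Q R : PolarForm F) : R.disp Q = Q.disp R := by
  obtain ⟨v, rfl⟩ := Q.exists_twist_eq R
  rw [disp_eq_iff, disp_twist, twist_twist, CharTwo.add_self_eq_zero, twist_zero]

theorem disp_smul (s : SemiSL F) (Q R : PolarForm F) : (s • Q).disp (s • R) = s • Q.disp R := by
  rw [disp_eq_iff, ← smul_twist, twist_disp]

/-- The invariant of a pair of forms. -/
noncomputable def inv (Q R : PolarForm F) : F := Q (Q.disp R)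

theorem inv_twist (Q : PolarForm F) (v : Fin 2 → F) : Q.inv (Q.twist v) = Q v := by
  rw [inv, disp_twist]

theorem inv_swap (Q R : PolarForm F) : R.inv Q = Q.inv R := by
  rw [inv, inv, disp_swap]
  nth_rewrite 1 [← Q.twist_disp R]
  rw [twist_apply_self]

theorem inv_smul (s : SemiSL F) (Q R : PolarForm F) :
    (s • Q).inv (s • R) = s.right (Q.inv R) := by
  rw [inv, inv, disp_smul, smul_apply_smul]

theorem inv_twist_twist (Q : PolarForm F) (v x : Fin 2 → F) :
    (Q.twist v).inv (Q.twist x) = Q v + Q x + symp v x + symp v x ^ 2 := by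
  have : Q.twist x = (Q.twist v).twist (v + x) := by
    rw [twist_twist, ← add_assoc, CharTwo.add_self_eq_zero, zero_add]
  rw [this, inv_twist, twist_apply, symp_add_right, symp_self, map_add, zero_add]

theorem inv_self (Q : PolarForm F) : Q.inv Q = 0 := by
  nth_rewrite 2 [← Q.twist_zero]
  rw [inv_twist, map_zero]

theorem Aniso.inv_eq_zero {Q R : PolarForm F} (hQ : Q.Aniso) : Q.inv R = 0 ↔ Q = R := by
  refine ⟨fun h => ?_, fun h => by rw [← h, inv_self]⟩
  rw [← Q.twist_disp R, hQ _ h, twist_zero]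

end PolarForm

/-! ### The Artin–Schreier map -/

section ArtinSchreier

variable (F : Type*) [Field F] [CharP F 2]

/-- The Artin-Schreier map `t ↦ t² + t`. -/
def artinSchreier : F →+ F where
  toFun t := t ^ 2 + t
  map_zero' := by simp
  map_add' x y := by rw [CharTwo.add_sq]; ring

variable {F}

theorem artinSchreier_apply (t : F) : artinSchreier F t = t ^ 2 + t := rfl

theorem artinSchreier_eq_iff {s t : F} :
    artinSchreier F s = artinSchreier F t ↔ s = t ∨ s = t + 1 := by
  rw [artinSchreier_apply, artinSchreier_apply]
  constructor
  · intro h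
    have h2 : (s - t) * (s - (t + 1)) = 0 := by
      linear_combination h - (s * t + s - t ^ 2 - t) * CharTwo.two_eq_zero (R := F)
    rcases mul_eq_zero.mp h2 with h3 | h3
    · exact Or.inl (sub_eq_zero.mp h3)
    · exact Or.inr (sub_eq_zero.mp h3)
  · rintro (rfl | rfl)
    · rfl
    · linear_combination (t + 1) * CharTwo.two_eq_zero (R := F)

theorem map_mem_artinSchreier_iff (σ : F ≃+* F) {x : F} :
    σ x ∈ (artinSchreier F).range ↔ x ∈ (artinSchreier F).range := by
  constructor
  · rintro ⟨t, ht⟩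
    refine ⟨σ.symm t, σ.injective ?_⟩
    simpa [artinSchreier_apply] using ht
  · rintro ⟨t, rfl⟩
    exact ⟨σ t, by simp [artinSchreier_apply]⟩

theorem artinSchreier_ker_card : Nat.card (artinSchreier F).ker = 2 := by
  have : ((artinSchreier F).ker : Set F) = {0, 1} := by
    ext t
    have := artinSchreier_eq_iff (s := t) (t := 0)
    rw [map_zero, zero_add] at this
    simpa [AddMonoidHom.mem_ker] using this
  rw [← SetLike.coe_sort_coe, this, Nat.card_coe_set_eq, Set.ncard_pair zero_ne_one]

theorem artinSchreier_range_card : 2 * Nat.card (artinSchreier F).range = Nat.card F := by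
  rw [← artinSchreier_ker_card (F := F), AddSubgroup.card_eq_card_quotient_mul_card_addSubgroup
    (artinSchreier F).ker, mul_comm]
  congr 1
  exact (Nat.card_congr (QuotientAddGroup.quotientKerEquivRange _).toEquiv).symm

variable [Finite F]

theorem artinSchreier_range_index : (artinSchreier F).range.index = 2 := by
  have h := (artinSchreier F).range.card_mul_index
  rw [← artinSchreier_range_card (F := F), mul_comm] at h
  exact Nat.eq_of_mul_eq_mul_right Nat.card_pos h

/-- The index is two, so two elements outside the range have their sum inside it; the Witt argument
rests on this. -/
theorem add_mem_artinSchreier_iff {x y : F} :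
    x + y ∈ (artinSchreier F).range ↔
      (x ∈ (artinSchreier F).range ↔ y ∈ (artinSchreier F).range) :=
  AddSubgroup.add_mem_iff_of_index_two artinSchreier_range_index

end ArtinSchreier

/-! ### The Arf invariant and Witt extension -/

namespace PolarForm

variable {F : Type*} [Field F] [CharP F 2]

/-- For t ≠ 0, multiplying Q(s v + t w) = 0 by Q v / t² gives r² + r = Q v * Q w with r = Q v * s /
t. The class of Q v * Q w modulo the Artin–Schreier range is the Arf invariant. -/
theorem aniso_iff (Q : PolarForm F) {v w : Fin 2 → F} (h : symp v w = 1) :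
    Q.Aniso ↔ Q v ≠ 0 ∧ Q v * Q w ∉ (artinSchreier F).range := by
  have hv : v ≠ 0 := by rintro rfl; simp [symp_zero_left] at h
  constructor
  · intro hQ
    have he : Q v ≠ 0 := fun h0 => hv (hQ v h0)
    refine ⟨he, ?_⟩
    rintro ⟨r, hr⟩
    rw [artinSchreier_apply] at hr
    have h0 : (r / Q v) • v + (1 : F) • w = 0 := by
      refine hQ _ ?_
      rw [map_comb, h]
      field_simp
      linear_combination hr + (Q v * Q w) * CharTwo.two_eq_zero (R := F)
    have := congrArg (symp v) h0
    rw [symp_add_right, symp_smul_right, symp_smul_right, symp_self, h] at this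
    simp [symp] at this
  · rintro ⟨he, hn⟩ x hx
    rw [eq_combination h x] at hx ⊢
    set s := symp x w
    set t := symp v x
    rw [map_comb, h] at hx
    by_cases ht : t = 0
    · rw [ht] at hx
      have : s = 0 := by simpa [he] using hx
      simp [ht, this]
    · refine absurd ⟨Q v * s / t, ?_⟩ hn
      rw [artinSchreier_apply]
      field_simp
      linear_combination hx - (Q w * t ^ 2) * CharTwo.two_eq_zero (R := F)

variable [Finite F]

/-- Twisting by v keeps Q v and adds 1 to Q w, so it changes the Arf invariant by Q v. -/
theorem Aniso.twist_iff {Q : PolarForm F} (hQ : Q.Aniso) (v : Fin 2 → F) :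
    (Q.twist v).Aniso ↔ Q v ∈ (artinSchreier F).range := by
  by_cases hv : v = 0
  · subst hv
    rw [twist_zero, map_zero]
    exact ⟨fun _ => zero_mem _, fun _ => hQ⟩
  obtain ⟨w, hw⟩ := exists_symp_eq_one hv
  have h1 := (Q.aniso_iff hw).mp hQ
  rw [aniso_iff _ hw, twist_apply_self, twist_apply, hw, one_pow, mul_add, mul_one,
    add_mem_artinSchreier_iff]
  tauto

theorem Aniso.inv_mem {Q R : PolarForm F} (hQ : Q.Aniso) (hR : R.Aniso) :
    Q.inv R ∈ (artinSchreier F).range := by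
  rw [← Q.twist_disp R, hQ.twist_iff] at hR
  exact hR

/-- Complete v and v' to hyperbolic pairs. Both Arf invariants are nontrivial, hence congruent, so
the second vector w' can be shifted along v' until its value under R is Q w. The element of SL(2,F)
matching the two pairs then matches the forms. -/
theorem exists_SL_smul_form {Q R : PolarForm F} (hQ : Q.Aniso) (hR : R.Aniso) {v v' : Fin 2 → F}
    (hv : v ≠ 0) (h : Q v = R v') :
    ∃ A : SpecialLinearGroup (Fin 2) F,
      (SemidirectProduct.inl A : SemiSL F) • Q = R ∧ A • v = v' := by
  have he : Q v ≠ 0 := fun h0 => hv (hQ v h0)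
  have hv' : v' ≠ 0 := by rintro rfl; rw [map_zero] at h; exact he h
  obtain ⟨w, hw⟩ := exists_symp_eq_one hv
  obtain ⟨w', hw'⟩ := exists_symp_eq_one hv'
  have h1 := ((Q.aniso_iff hw).mp hQ).2
  have h2 := ((R.aniso_iff hw').mp hR).2
  rw [← h] at h2
  obtain ⟨r, hr⟩ : Q v * Q w + Q v * R w' ∈ (artinSchreier F).range := by
    rw [add_mem_artinSchreier_iff]; tauto
  rw [artinSchreier_apply] at hr
  have hw2 : symp v' ((r / Q v) • v' + (1 : F) • w') = 1 := by
    rw [symp_add_right, symp_smul_right, symp_smul_right, symp_self, hw']; simp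
  have hval : R ((r / Q v) • v' + (1 : F) • w') = Q w := by
    rw [map_comb, hw', ← h]
    field_simp
    linear_combination hr + (Q v * R w') * CharTwo.two_eq_zero (R := F)
  obtain ⟨A, hA, hA'⟩ := exists_SL_smul_eq hw hw2
  refine ⟨A, eq_of_pair hw2 ?_ ?_, hA⟩
  · have := smul_apply_smul (SemidirectProduct.inl A) Q v
    rw [inl_smul, hA] at this
    exact this.trans h
  · have := smul_apply_smul (SemidirectProduct.inl A) Q w
    rw [inl_smul, hA'] at this
    exact this.trans hval.symm

end PolarForm

/-! ### Automorphisms of the field with 2^d elements -/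

section FieldFacts

variable {F : Type*} [Field F] {d : ℕ}

theorem charP_two [Finite F] (hF : Nat.card F = 2 ^ d) : CharP F 2 := by
  have := Fintype.ofFinite F
  have : Fact (Nat.Prime 2) := ⟨Nat.prime_two⟩
  exact charP_of_card_eq_prime_pow (f := d) (by rw [← Nat.card_eq_fintype_card, hF])

theorem card_ringAut [Finite F] (hF : Nat.card F = 2 ^ d) : Nat.card (F ≃+* F) = d := by
  have := charP_two hF
  have : Fact (Nat.Prime 2) := ⟨Nat.prime_two⟩
  let _ : Algebra (ZMod 2) F := ZMod.algebra F 2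
  have e : (F ≃+* F) ≃ Gal(F/(ZMod 2)) :=
    { toFun := fun σ => AlgEquiv.ofRingEquiv (f := σ) fun x =>
        RingHom.congr_fun (Subsingleton.elim ((σ : F →+* F).comp (algebraMap (ZMod 2) F))
          (algebraMap (ZMod 2) F)) x
      invFun := fun σ => σ.toRingEquiv
      left_inv := fun σ => rfl
      right_inv := fun σ => rfl }
  rw [Nat.card_congr e, IsGalois.card_aut_eq_finrank]
  have h := Module.natCard_eq_pow_finrank (K := ZMod 2) (V := F)
  rw [hF, Nat.card_zmod] at h
  exact (Nat.pow_right_injective le_rfl h).symm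

instance [Finite F] : Finite (F ≃+* F) :=
  Finite.of_injective (fun σ : F ≃+* F => (σ : F → F)) DFunLike.coe_injective

/-- Aut(F) has prime order, so σ generates it and a fixed point of σ is fixed by Frobenius. -/
theorem eq_zero_or_one_of_fixed [Finite F] (hd : d.Prime) (hF : Nat.card F = 2 ^ d)
    {σ : F ≃+* F} (hσ : σ ≠ 1) {x : F} (hx : σ x = x) : x = 0 ∨ x = 1 := by
  have := charP_two hF
  have : Fact (Nat.Prime 2) := ⟨Nat.prime_two⟩
  have : Fact d.Prime := ⟨hd⟩
  obtain ⟨n, hn⟩ := mem_zpowers_of_prime_card (card_ringAut hF) (g' := frobeniusEquiv F 2) hσ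
  have h2 : ∀ n : ℤ, (σ ^ n) x = x := fun n => by
    have hs : σ ∈ MulAction.stabilizer (F ≃+* F) x := hx
    exact Subgroup.zpow_mem _ hs n
  have h3 : x ^ 2 = x := by
    have h3 := h2 n
    rw [show σ ^ n = frobeniusEquiv F 2 from hn] at h3
    exact h3
  have h4 : x * (x - 1) = 0 := by linear_combination h3
  rcases mul_eq_zero.mp h4 with h | h
  · exact Or.inl h
  · exact Or.inr (sub_eq_zero.mp h)

theorem natCast_eq_zero_of_even [CharP F 2] {n : ℕ} (h : Even n) : (n : F) = 0 := by
  obtain ⟨m, rfl⟩ := h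
  rw [Nat.cast_add, CharTwo.add_self_eq_zero]

theorem natCast_eq_one_of_odd [CharP F 2] {n : ℕ} (h : Odd n) : (n : F) = 1 := by
  obtain ⟨m, rfl⟩ := h
  rw [Nat.cast_add, natCast_eq_zero_of_even (even_two_mul m), Nat.cast_one, zero_add]

theorem one_notMem_artinSchreier [Finite F] [CharP F 2] (hd : Odd d) (hF : Nat.card F = 2 ^ d) :
    (1 : F) ∉ (artinSchreier F).range := by
  rintro ⟨t, ht⟩
  rw [artinSchreier_apply] at ht
  -- If t² = t + 1, each Frobenius step adds 1; after d steps t returns to itself, yet d is 1 in F.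
  have h1 : ∀ n : ℕ, t ^ 2 ^ n = t + n := by
    intro n
    induction n with
    | zero => simp
    | succ n ih =>
      rw [pow_succ, pow_mul, ih, CharTwo.add_sq]
      have : (n : F) ^ 2 = n := by
        rcases Nat.even_or_odd n with h | h
        · rw [natCast_eq_zero_of_even h]; simp
        · rw [natCast_eq_one_of_odd h]; simp
      rw [this]
      push_cast
      linear_combination ht - t * CharTwo.two_eq_zero (R := F)
  have h2 := h1 d
  have := Fintype.ofFinite F
  rw [← hF, Nat.card_eq_fintype_card, FiniteField.pow_card,
    natCast_eq_one_of_odd hd] at h2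
  simp at h2

/-- A nontrivial automorphism fixes no nonzero element `t² + t`. -/
theorem map_ne_self [Finite F] [CharP F 2] (hd : d.Prime) (hd3 : 3 ≤ d) (hF : Nat.card F = 2 ^ d)
    {σ : F ≃+* F} (hσ : σ ≠ 1) {x : F} (hx : x ∈ (artinSchreier F).range) (h0 : x ≠ 0) :
    σ x ≠ x := fun h => by
  rcases eq_zero_or_one_of_fixed hd hF hσ h with rfl | rfl
  · exact h0 rfl
  · exact one_notMem_artinSchreier (hd.odd_of_ne_two (by omega)) hF hx

end FieldFacts

/-! ### Fibre counts and fixed points in cosets -/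

section Counting

theorem ncard_eq_mul_of_fibers {α β : Type*} [Finite α] [Finite β] {s : Set α} {P : Set β}
    (f : α → β) {c : ℕ} (hs : ∀ a ∈ s, f a ∈ P) (hc : ∀ b ∈ P, {a ∈ s | f a = b}.ncard = c) :
    s.ncard = P.ncard * c := by
  classical
  have := Fintype.ofFinite α
  have := Fintype.ofFinite β
  rw [Set.ncard_eq_toFinset_card', Set.ncard_eq_toFinset_card',
    Finset.card_eq_sum_card_fiberwise (f := f) (t := P.toFinset) (fun a ha => by
      simpa using hs a (by simpa using ha)), Finset.sum_const_nat]
  intro b hb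
  rw [← hc b (by simpa using hb), Set.ncard_eq_toFinset_card']
  congr 1
  ext a
  simp

theorem card_orbit_mul_card_transporter {G X : Type*} [Group G] [MulAction G X] {x y : X}
    (h : y ∈ MulAction.orbit G x) :
    (MulAction.orbit G x).ncard * {g : G | g • x = y}.ncard = Nat.card G := by
  obtain ⟨g, rfl⟩ := h
  have h1 : {g' : G | g' • x = g • x} = (fun u => g * u) '' (MulAction.stabilizer G x : Set G) := by
    ext u
    constructor
    · intro hu
      refine ⟨g⁻¹ * u, ?_, by simp⟩
      change (g⁻¹ * u) • x = x
      rw [mul_smul, inv_smul_eq_iff]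
      exact hu
    · rintro ⟨v, hv, rfl⟩
      change (g * v) • x = g • x
      rw [mul_smul, show v • x = x from hv]
  change (MulAction.orbit G x).ncard * {g' : G | g' • x = g • x}.ncard = _
  rw [h1, Set.ncard_image_of_injective _ (mul_right_injective g), ← Nat.card_coe_set_eq,
    ← Nat.card_coe_set_eq, Nat.card_congr (MulAction.orbitEquivQuotientStabilizer G x), mul_comm]
  exact (MulAction.stabilizer G x).card_mul_index

/-- In a coset of a transitive group none of whose elements fixes two points, every element has
a fixed point. -/
theorem exists_fixed_of_subsingleton_fixed {G X : Type*} [Group G] [MulAction G X] [Finite G]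
    [Finite X] [Nonempty X] [MulAction.IsPretransitive G X] (τ : X → X)
    (h : ∀ (g : G) (x y : X), g • τ x = x → g • τ y = y → x = y) (g : G) : ∃ x, g • τ x = x := by
  -- Double count: each x lies in |G|/|X| of these pairs, which makes |G| pairs in all. Each g lies
  -- in at most one, hence in exactly one.
  let s : Set (G × X) := {p | p.1 • τ p.2 = p.2}
  have hs : Nat.card s = Nat.card G := by
    have hX : 0 < Nat.card X := Nat.card_pos
    rw [Nat.card_coe_set_eq, ncard_eq_mul_of_fibers (s := s) (P := Set.univ)
      (c := Nat.card G / Nat.card X) Prod.snd (fun _ _ => Set.mem_univ _), Set.ncard_univ]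
    · obtain ⟨x⟩ := ‹Nonempty X›
      have h1 := card_orbit_mul_card_transporter (MulAction.mem_orbit_self (M := G) x)
      rw [MulAction.orbit_eq_univ, Set.ncard_univ] at h1
      exact Nat.mul_div_cancel' ⟨_, h1.symm⟩
    · intro x _
      have h1 := card_orbit_mul_card_transporter
        (show x ∈ MulAction.orbit G (τ x) by rw [MulAction.orbit_eq_univ]; trivial)
      rw [MulAction.orbit_eq_univ, Set.ncard_univ] at h1
      rw [← h1, Nat.mul_div_cancel_left _ hX,
        ← Set.ncard_image_of_injective {g : G | g • τ x = x} (Prod.mk_left_injective x)]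
      congr 1
      ext ⟨g, y⟩
      constructor
      · rintro ⟨h2, h3⟩
        obtain rfl : y = x := h3
        exact ⟨g, h2, rfl⟩
      · rintro ⟨g', h2, h3⟩
        obtain ⟨rfl, rfl⟩ := Prod.mk.inj h3
        exact ⟨h2, rfl⟩
  have hinj : Function.Injective (fun p : s => p.1.1) := by
    rintro ⟨⟨g, x⟩, hx⟩ ⟨⟨g', y⟩, hy⟩ hxy
    obtain rfl : g = g' := hxy
    obtain rfl := h g x y hx hy
    rfl
  obtain ⟨⟨⟨g', x⟩, hx⟩, rfl⟩ := (hinj.bijective_of_nat_card_le hs.ge).2 g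
  exact ⟨x, hx⟩

end Counting

/-! ### Counting points on conics and lines -/

namespace PolarForm

variable {F : Type*} [Field F] [Finite F]

/-- A line meets a conic in at most two points. -/
theorem Aniso.ncard_line_inter_level {Q : PolarForm F} (hQ : Q.Aniso) {v : Fin 2 → F} (hv : v ≠ 0)
    (b e : F) : {x | symp v x = b ∧ Q x = e}.ncard ≤ 2 := by
  have he : Q v ≠ 0 := fun h => hv (hQ v h)
  rcases Set.eq_empty_or_nonempty {x | symp v x = b ∧ Q x = e} with h | ⟨x₀, hb, hx₀⟩
  · rw [h]; simp
  obtain ⟨w, hw⟩ := exists_symp_eq_one hv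
  -- Along x₀ + s v the condition Q = e is a quadratic equation in s with root 0; the other root is
  -- b / Q v.
  refine le_trans (Set.ncard_le_ncard (t := {x₀, x₀ + (b / Q v) • v}) ?_ (Set.toFinite _))
    (Set.ncard_insert_le _ _ |>.trans (by simp))
  rintro x ⟨hxb, hx⟩
  obtain ⟨s, rfl⟩ : ∃ s : F, x = x₀ + s • v := by
    refine ⟨symp (x - x₀) w, ?_⟩
    have h0 : symp v (x - x₀) = 0 := by
      have := symp_add_right v (x - x₀) x₀
      rw [sub_add_cancel, hxb, hb] at this
      linear_combination -this
    have := eq_combination hw (x - x₀)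
    rw [h0, zero_smul, add_zero] at this
    rw [← this]; simp
  rw [map_add, map_smul, symp_smul_right, symp_swap, hb, hx₀] at hx
  have h5 : s * (s * Q v - b) = 0 := by linear_combination hx
  rcases mul_eq_zero.mp h5 with h | h
  · left; simp [h]
  · right
    rw [Set.mem_singleton_iff, ← sub_eq_zero.mp h]
    field_simp

variable [CharP F 2]

theorem ncard_level_eq {Q : PolarForm F} {e e' : F} (he : e ≠ 0)
    (he' : e' ≠ 0) : {x | Q x = e}.ncard = {x | Q x = e'}.ncard := by
  obtain ⟨t, ht⟩ : ∃ t : F, t ^ 2 = e' / e :=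
    (Finite.injective_iff_surjective.mp (fun a b => CharTwo.sq_inj.mp) :
      Function.Surjective fun x : F => x ^ 2) _
  have ht0 : t ≠ 0 := by
    rintro rfl
    have : e' / e ≠ 0 := div_ne_zero he' he
    simp at ht
    tauto
  rw [← Set.ncard_image_of_injective _ (smul_right_injective (Fin 2 → F) ht0)]
  congr 1
  ext x
  constructor
  · rintro ⟨y, hy, rfl⟩
    change Q (t • y) = e'
    rw [map_smul, ht, show Q y = e from hy]
    field_simp
  · intro hx
    refine ⟨t⁻¹ • x, ?_, by simp [smul_smul, ht0]⟩
    change Q (t⁻¹ • x) = e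
    rw [map_smul, inv_pow, ht, show Q x = e' from hx]
    field_simp

/-- Scaling makes all q - 1 nonzero levels equally large, and they share the q² - 1 nonzero vectors.
-/
theorem Aniso.ncard_level {Q : PolarForm F} (hQ : Q.Aniso) {e : F} (he : e ≠ 0) :
    {x | Q x = e}.ncard = Nat.card F + 1 := by
  have h1 := ncard_eq_mul_of_fibers (s := {x : Fin 2 → F | x ≠ 0}) (P := {e : F | e ≠ 0})
    (c := {x | Q x = e}.ncard) (fun x => Q x) (fun a ha h => ha (hQ a h)) (fun b hb => by
      rw [ncard_level_eq he hb]
      congr 1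
      ext x
      constructor
      · exact fun h => h.2
      · intro h
        refine ⟨?_, h⟩
        rintro rfl
        rw [Set.mem_ofPred_eq, map_zero] at h
        exact hb h.symm)
  have h2 : ∀ α : Type _, ∀ [Finite α] (a : α), {x : α | x ≠ a}.ncard = Nat.card α - 1 := by
    intro α _ a
    rw [← Set.ncard_singleton a, ← Set.ncard_compl]
    rfl
  rw [h2, h2, Nat.card_fun, Nat.card_fin] at h1
  have h3 : 1 < Nat.card F := Finite.one_lt_card
  obtain ⟨m, hm⟩ : ∃ m, Nat.card F = m + 1 + 1 := ⟨Nat.card F - 2, by omega⟩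
  rw [hm] at h1 ⊢
  have h4 : (m + 1 + 1) ^ 2 - 1 = (m + 1) * (m + 1 + 1 + 1) := by
    rw [Nat.sub_eq_iff_eq_add (Nat.one_le_pow _ _ (by omega))]; ring
  rw [h4] at h1
  exact (Nat.eq_of_mul_eq_mul_left (by omega) h1).symm

/-- The zero vector, together with q + 1 vectors for each of the q/2 - 1 nonzero values. -/
theorem Aniso.ncard_artinSchreier {Q : PolarForm F} (hQ : Q.Aniso) :
    2 * {x | Q x ∈ (artinSchreier F).range}.ncard = Nat.card F * (Nat.card F - 1) := by
  have h1 := ncard_eq_mul_of_fibers (s := {x | Q x ∈ (artinSchreier F).range ∧ x ≠ 0})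
    (P := {e : F | e ∈ (artinSchreier F).range ∧ e ≠ 0}) (c := Nat.card F + 1)
    (fun x => Q x) (fun a ha => ⟨ha.1, fun h => ha.2 (hQ a h)⟩) (fun b hb => by
      rw [← hQ.ncard_level hb.2]
      congr 1
      ext x
      constructor
      · exact fun h => h.2
      · intro h
        rw [Set.mem_ofPred_eq] at h
        refine ⟨⟨by rw [h]; exact hb.1, ?_⟩, h⟩
        rintro rfl
        rw [map_zero] at h
        exact hb.2 h.symm)
  have h2 : ∀ α : Type _, ∀ [Finite α] (p : α → Prop) (a : α), p a →
      {x : α | p x}.ncard = {x : α | p x ∧ x ≠ a}.ncard + 1 := by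
    intro α _ p a ha
    rw [← Set.ncard_sdiff_singleton_add_one (s := {x : α | p x}) ha]
    rfl
  rw [h2 _ _ 0 (by rw [map_zero]; exact zero_mem _), h1]
  have h3 := h2 F (fun e => e ∈ (artinSchreier F).range) 0 (zero_mem _)
  have h4 := artinSchreier_range_card (F := F)
  rw [← SetLike.coe_sort_coe, Nat.card_coe_set_eq] at h4
  change 2 * {e : F | e ∈ (artinSchreier F).range}.ncard = _ at h4
  rw [h3] at h4
  rw [← h4]
  generalize {e : F | e ∈ (artinSchreier F).range ∧ e ≠ 0}.ncard = m
  rw [show 2 * (m + 1) - 1 = 2 * m + 1 by omega]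
  ring

/-- On the line t v + b w, the form Q is t² b + b² Q w plus the Artin–Schreier image of t b. The
last term does not affect membership, and the rest is a bijective function of t, so half of the line
qualifies. -/
theorem Aniso.ncard_line_inter_artinSchreier {Q : PolarForm F} (hQ : Q.Aniso) {v : Fin 2 → F}
    (hv : v ≠ 0) {b : F} (hb : Q v = b ^ 2 + b) :
    2 * {x | symp v x = b ∧ Q x ∈ (artinSchreier F).range}.ncard = Nat.card F := by
  have he : Q v ≠ 0 := fun h => hv (hQ v h)
  have hb0 : b ≠ 0 := by rintro rfl; simp [hb] at he
  obtain ⟨w, hw⟩ := exists_symp_eq_one hv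
  have hinj : Function.Injective fun t : F => t • v + b • w := fun s t h =>
    smul_left_injective F hv (add_right_cancel h)
  have hinj2 : Function.Injective fun t : F => t ^ 2 * b + b ^ 2 * Q w := fun s t h =>
    CharTwo.sq_inj.mp (mul_right_cancel₀ hb0 (add_right_cancel h))
  have key : {x | symp v x = b ∧ Q x ∈ (artinSchreier F).range} =
      (fun t : F => t • v + b • w) ''
        ((fun t : F => t ^ 2 * b + b ^ 2 * Q w) ⁻¹' ((artinSchreier F).range : Set F)) := by
    have hQt : ∀ t : F, Q (t • v + b • w) ∈ (artinSchreier F).range ↔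
        t ^ 2 * b + b ^ 2 * Q w ∈ (artinSchreier F).range := fun t => by
      have : Q (t • v + b • w) = (t ^ 2 * b + b ^ 2 * Q w) + artinSchreier F (t * b) := by
        rw [map_comb, hw, artinSchreier_apply, hb]; ring
      rw [this, add_mem_artinSchreier_iff]
      exact iff_true_right ⟨_, rfl⟩
    ext x
    constructor
    · rintro ⟨hx, hx2⟩
      have h3 := eq_combination hw x
      rw [hx] at h3
      refine ⟨symp x w, ?_, h3.symm⟩
      rw [h3] at hx2
      exact (hQt _).mp hx2
    · rintro ⟨t, ht, rfl⟩
      refine ⟨?_, (hQt t).mpr ht⟩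
      rw [symp_add_right, symp_smul_right, symp_smul_right, symp_self, hw]
      ring
  rw [key, Set.ncard_image_of_injective _ hinj,
    Set.ncard_preimage_of_injective_subset_range hinj2 (fun y _ =>
      Finite.injective_iff_surjective.mp hinj2 y), ← Nat.card_coe_set_eq]
  exact artinSchreier_range_card

end PolarForm

/-! ### The model: pairs of anisotropic forms and circles -/

instance {F : Type*} [Field F] [Finite F] : Finite (PolarForm F) :=
  Finite.of_injective PolarForm.toFun fun _ _ => PolarForm.ext

instance {F : Type*} [Field F] [Finite F] : Finite (SemiSL F) :=
  Finite.of_equiv _ SemidirectProduct.equivProd.symm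

/-- The set of anisotropic forms, a model of the point set of the Hollmann schemes. -/
abbrev Elliptic (F : Type*) [Field F] : Type _ := {Q : PolarForm F // Q.Aniso}

namespace Elliptic

variable {F : Type*} [Field F]

instance : MulAction (SemiSL F) (Elliptic F) where
  smul s α := ⟨s • α.1, α.2.smul s⟩
  one_smul α := Subtype.ext (one_smul _ α.1)
  mul_smul s t α := Subtype.ext (mul_smul s t α.1)

instance : MulAction (SpecialLinearGroup (Fin 2) F) (Elliptic F) :=
  MulAction.compHom _ (SemidirectProduct.inl : _ →* SemiSL F)

variable [CharP F 2] [Finite F]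

/-- The invariant of a pair of points. -/
noncomputable def inv (α β : Elliptic F) : F := α.1.inv β.1

theorem inv_swap (α β : Elliptic F) : β.inv α = α.inv β := PolarForm.inv_swap _ _

theorem inv_mem (α β : Elliptic F) : α.inv β ∈ (artinSchreier F).range := α.2.inv_mem β.2

theorem inv_eq_zero {α β : Elliptic F} : α.inv β = 0 ↔ α = β :=
  α.2.inv_eq_zero.trans Subtype.ext_iff.symm

theorem inv_smul (s : SemiSL F) (α β : Elliptic F) : (s • α).inv (s • β) = s.right (α.inv β) :=
  PolarForm.inv_smul s _ _

theorem inv_SL_smul (A : SpecialLinearGroup (Fin 2) F) (α β : Elliptic F) :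
    (A • α).inv (A • β) = α.inv β :=
  inv_smul _ α β

theorem exists_SL_smul (α β α' β' : Elliptic F) (h : α.inv β = α'.inv β') :
    ∃ A : SpecialLinearGroup (Fin 2) F, A • α = α' ∧ A • β = β' := by
  have hsmul : ∀ (A : SpecialLinearGroup (Fin 2) F) (α α' : Elliptic F),
      (SemidirectProduct.inl A : SemiSL F) • α.1 = α'.1 → A • α = α' :=
    fun A α α' h => Subtype.ext h
  by_cases hαβ : α = β
  · obtain rfl := hαβ
    rw [inv_eq_zero.mpr rfl] at h
    obtain rfl := inv_eq_zero.mp h.symm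
    -- On the diagonal the displacement is zero and useless for Witt extension; any nonzero vector
    -- will do, once rescaled so that the two values agree.
    obtain ⟨t, ht⟩ := (Finite.injective_iff_surjective.mp (fun a b => CharTwo.sq_inj.mp) :
      Function.Surjective fun x : F => x ^ 2) (α.1 ![1, 0] / α'.1 ![1, 0])
    have h1 : α'.1 ![1, 0] ≠ 0 := fun h => by simpa using congrFun (α'.2 _ h) 0
    obtain ⟨A, hA, -⟩ := PolarForm.exists_SL_smul_form α.2 α'.2 (v := ![1, 0])
      (v' := t • ![1, 0]) (fun h => by simpa using congrFun h 0) (by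
        rw [PolarForm.map_smul, show t ^ 2 = _ from ht]; field_simp)
    exact ⟨A, hsmul _ _ _ hA, hsmul _ _ _ hA⟩
  · obtain ⟨A, hA, hA'⟩ := PolarForm.exists_SL_smul_form α.2 α'.2 (v := α.1.disp β.1)
      (v' := α'.1.disp β'.1) (fun h0 => hαβ (Subtype.ext (by
        rw [← α.1.twist_disp β.1, h0, PolarForm.twist_zero]))) h
    refine ⟨A, hsmul _ _ _ hA, hsmul _ _ _ ?_⟩
    rw [← α.1.twist_disp β.1, PolarForm.smul_twist, hA, inl_smul, hA', PolarForm.twist_disp]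

instance : MulAction.IsPretransitive (SpecialLinearGroup (Fin 2) F) (Elliptic F) where
  exists_smul_eq α β := by
    obtain ⟨A, hA, -⟩ := exists_SL_smul α α β β (by rw [inv_eq_zero.mpr rfl, inv_eq_zero.mpr rfl])
    exact ⟨A, hA⟩

/-- Taking α as origin of the affine plane turns counts of points into counts of vectors x with α(x)
in the Artin–Schreier range. -/
theorem ncard_eq_of_disp (α : Elliptic F) {p : Elliptic F → Prop} {p' : (Fin 2 → F) → Prop}
    (h : ∀ (γ : Elliptic F) x, γ.1 = α.1.twist x → (p γ ↔ p' x)) :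
    {γ | p γ}.ncard = {x | α.1 x ∈ (artinSchreier F).range ∧ p' x}.ncard := by
  have hinj : Function.Injective fun γ : Elliptic F => α.1.disp γ.1 := fun γ δ h => by
    apply Subtype.ext
    rw [← α.1.twist_disp γ.1, ← α.1.twist_disp δ.1]
    exact congrArg _ h
  rw [← Set.ncard_image_of_injective _ hinj]
  congr 1
  ext x
  constructor
  · rintro ⟨γ, hγ, rfl⟩
    refine ⟨?_, (h γ _ (α.1.twist_disp γ.1).symm).mp hγ⟩
    rw [← α.2.twist_iff, α.1.twist_disp]
    exact γ.2
  · rintro ⟨hx, hx'⟩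
    exact ⟨⟨α.1.twist x, (α.2.twist_iff x).mpr hx⟩, (h _ x rfl).mpr hx', α.1.disp_twist x⟩

theorem two_mul_card (α : Elliptic F) : 2 * Nat.card (Elliptic F) = Nat.card F * (Nat.card F - 1) := by
  rw [← α.2.ncard_artinSchreier, ← Set.ncard_univ]
  congr 1
  exact (ncard_eq_of_disp α (p := fun _ => True) (p' := fun _ => True) fun _ _ _ => Iff.rfl).trans
    (by simp)

theorem ncard_inv_eq (α : Elliptic F) {e : F} (he : e ∈ (artinSchreier F).range) (he0 : e ≠ 0) :
    {γ | α.inv γ = e}.ncard = Nat.card F + 1 := by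
  rw [← α.2.ncard_level he0, ncard_eq_of_disp α (p' := fun x => α.1 x = e)]
  · congr 1
    ext x
    constructor
    · exact fun h => h.2
    · intro h
      refine ⟨?_, h⟩
      rw [show α.1 x = e from h]
      exact he
  · intro γ x hx
    rw [inv, hx, PolarForm.inv_twist]

theorem disp_ne_zero {α β : Elliptic F} (h : α ≠ β) : α.1.disp β.1 ≠ 0 := fun h0 =>
  h (Subtype.ext (by rw [← α.1.twist_disp β.1, h0, PolarForm.twist_zero]))

/-- A law of cosines with v the displacement from α to β: once inv(α,γ) is given, inv(β,γ) depends
only on `artinSchreier` of B(v,x), so prescribing it confines x to two parallel lines. -/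
theorem inv_of_twist {α β γ : Elliptic F} {x : Fin 2 → F} (hx : γ.1 = α.1.twist x) :
    β.inv γ = α.1 (α.1.disp β.1) + α.1 x + artinSchreier F (symp (α.1.disp β.1) x) := by
  rw [inv, hx]
  nth_rewrite 1 [← α.1.twist_disp β.1]
  rw [PolarForm.inv_twist_twist, artinSchreier_apply]
  ring

/-- The number of points equidistant from two given points. -/
theorem ncard_inv_eq_inv {α β : Elliptic F} (h : α ≠ β) :
    {γ | β.inv γ = α.inv γ}.ncard = Nat.card F := by
  have hv := disp_ne_zero h
  obtain ⟨b, hb⟩ := α.inv_mem β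
  have hb1 : α.1 (α.1.disp β.1) = artinSchreier F b := hb.symm
  -- Equidistance reads `artinSchreier` of B(v,x) = `artinSchreier` of b: two parallel lines, each
  -- with q/2 admissible points.
  have hb2 : artinSchreier F b = artinSchreier F (b + 1) := artinSchreier_eq_iff.mpr (by
    right; rw [add_assoc, CharTwo.add_self_eq_zero, add_zero])
  rw [ncard_eq_of_disp α (p' := fun x => symp (α.1.disp β.1) x = b ∨
    symp (α.1.disp β.1) x = b + 1)]
  · have key : {x | α.1 x ∈ (artinSchreier F).range ∧
        (symp (α.1.disp β.1) x = b ∨ symp (α.1.disp β.1) x = b + 1)} =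
        {x | symp (α.1.disp β.1) x = b ∧ α.1 x ∈ (artinSchreier F).range} ∪
        {x | symp (α.1.disp β.1) x = b + 1 ∧ α.1 x ∈ (artinSchreier F).range} := by
      ext x
      simp only [Set.mem_ofPred_eq, Set.mem_union]
      tauto
    rw [key, Set.ncard_union_eq]
    · have h1 := α.2.ncard_line_inter_artinSchreier hv hb1
      have h2 := α.2.ncard_line_inter_artinSchreier hv (hb1.trans hb2)
      omega
    · rw [Set.disjoint_left]
      rintro x ⟨hx, -⟩ ⟨hx', -⟩
      simp [hx] at hx'
  · intro γ x hx
    rw [inv_of_twist hx, inv, hx, PolarForm.inv_twist, hb1, ← artinSchreier_eq_iff]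
    constructor
    · intro h
      linear_combination h - artinSchreier F b * CharTwo.two_eq_zero (R := F)
    · intro h
      linear_combination h + artinSchreier F b * CharTwo.two_eq_zero (R := F)

/-- Two circles with distinct centres meet in at most four points. -/
theorem ncard_inter_le {α β : Elliptic F} (h : α ≠ β) (e e' : F) :
    {γ | α.inv γ = e ∧ β.inv γ = e'}.ncard ≤ 4 := by
  have hv := disp_ne_zero h
  rcases Set.eq_empty_or_nonempty {γ | α.inv γ = e ∧ β.inv γ = e'} with h0 | ⟨γ₀, h1, h2⟩
  · rw [h0]; simp
  set v := α.1.disp β.1 with hvdef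
  -- One common point γ₀ pins all the others to the lines B(v,x) = b and B(v,x) = b + 1, each
  -- meeting the conic at most twice.
  set b := symp v (α.1.disp γ₀.1)
  rw [ncard_eq_of_disp α (p' := fun x => (symp v x = b ∧ α.1 x = e) ∨
    (symp v x = b + 1 ∧ α.1 x = e))]
  · refine le_trans (Set.ncard_le_ncard (t := {x | symp v x = b ∧ α.1 x = e} ∪
      {x | symp v x = b + 1 ∧ α.1 x = e}) (fun x hx => hx.2) (Set.toFinite _))
      ((Set.ncard_union_le _ _).trans ?_)
    have h3 := α.2.ncard_line_inter_level hv b e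
    have h4 := α.2.ncard_line_inter_level hv (b + 1) e
    omega
  · intro γ x hx
    rw [inv_of_twist (α.1.twist_disp γ₀.1).symm] at h2
    rw [inv_of_twist (β := β) hx, inv, hx, PolarForm.inv_twist, ← or_and_right, ← artinSchreier_eq_iff,
      and_comm, and_congr_left_iff]
    intro h5
    have h6 : α.1 (α.1.disp γ₀.1) = e := h1
    rw [h5, ← hvdef]
    rw [h6, ← hvdef] at h2
    rw [← h2]
    exact ⟨add_left_cancel, congrArg _⟩

/-! ### Points whose distances differ by a field automorphism -/

section Twisted

variable {d : ℕ} (hd : d.Prime) (hd3 : 3 ≤ d) (hF : Nat.card F = 2 ^ d)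

theorem card_transporter_mul (α β : Elliptic F) :
    Nat.card (Elliptic F) * {A : SpecialLinearGroup (Fin 2) F | A • α = β}.ncard =
      Nat.card (SpecialLinearGroup (Fin 2) F) := by
  have h1 := card_orbit_mul_card_transporter
    (show β ∈ MulAction.orbit (SpecialLinearGroup (Fin 2) F) α by
      rw [MulAction.orbit_eq_univ]; trivial)
  rwa [MulAction.orbit_eq_univ, Set.ncard_univ] at h1

/-- The orbit of (α,β) consists of all pairs with the same invariant, q + 1 for each first point, so
the transporter has the same size for every admissible target. -/
theorem card_pair_transporter_mul {α β α' β' : Elliptic F} (h : α ≠ β)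
    (h' : α.inv β = α'.inv β') :
    Nat.card (Elliptic F) * (Nat.card F + 1) *
      {A : SpecialLinearGroup (Fin 2) F | A • α = α' ∧ A • β = β'}.ncard =
      Nat.card (SpecialLinearGroup (Fin 2) F) := by
  obtain ⟨A, hA⟩ := exists_SL_smul α β α' β' h'
  have h1 := card_orbit_mul_card_transporter
    (show (α', β') ∈ MulAction.orbit (SpecialLinearGroup (Fin 2) F) (α, β) from
      ⟨A, Prod.ext hA.1 hA.2⟩)
  have h2 : MulAction.orbit (SpecialLinearGroup (Fin 2) F) (α, β) =
      {p | p.1.inv p.2 = α.inv β} := by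
    ext ⟨γ, δ⟩
    constructor
    · rintro ⟨B, hB⟩
      obtain ⟨rfl, rfl⟩ := Prod.mk.inj hB
      exact inv_SL_smul B α β
    · intro h3
      obtain ⟨B, hB⟩ := exists_SL_smul α β γ δ h3.symm
      exact ⟨B, Prod.ext hB.1 hB.2⟩
  have h3 : {p : Elliptic F × Elliptic F | p.1.inv p.2 = α.inv β}.ncard =
      Nat.card (Elliptic F) * (Nat.card F + 1) := by
    rw [ncard_eq_mul_of_fibers (P := Set.univ) (c := Nat.card F + 1) Prod.fst
      (fun _ _ => Set.mem_univ _), Set.ncard_univ]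
    intro γ _
    rw [← ncard_inv_eq γ (α.inv_mem β) (fun h0 => h (inv_eq_zero.mp h0)),
      ← Set.ncard_image_of_injective {δ | γ.inv δ = α.inv β} (Prod.mk_right_injective γ)]
    congr 1
    ext ⟨γ', δ⟩
    constructor
    · rintro ⟨h4, h5⟩
      obtain rfl : γ' = γ := h5
      exact ⟨δ, h4, rfl⟩
    · rintro ⟨δ', h4, h5⟩
      obtain ⟨rfl, rfl⟩ := Prod.mk.inj h5
      exact ⟨h4, rfl⟩
  rw [h2, h3] at h1
  rw [← h1]
  congr 2
  ext B
  exact Prod.mk_inj.symm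

include hd hd3 hF in
/-- The number of points whose distances from two given points are related by a fixed nontrivial
field automorphism. -/
theorem ncard_inv_eq_map_inv {α β : Elliptic F} (h : α ≠ β) {σ : F ≃+* F} (hσ : σ ≠ 1) :
    {γ | β.inv γ = σ (α.inv γ)}.ncard = Nat.card F + 1 := by
  let τ : Elliptic F → Elliptic F := fun γ => (SemidirectProduct.inr σ : SemiSL F) • γ
  have hτ : ∀ γ δ, (τ γ).inv (τ δ) = σ (γ.inv δ) := fun γ δ => inv_smul _ γ δ
  -- Two distinct fixed points of Aτ would have a nonzero invariant fixed by σ, contrary to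
  -- `map_ne_self`.
  have hsub : ∀ (A : SpecialLinearGroup (Fin 2) F) (x y : Elliptic F),
      A • τ x = x → A • τ y = y → x = y := fun A x y hx hy => by
    by_contra hxy
    have h1 := inv_SL_smul A (τ x) (τ y)
    rw [hx, hy, hτ] at h1
    exact map_ne_self hd hd3 hF hσ (x.inv_mem y) (fun h0 => hxy (inv_eq_zero.mp h0)) h1.symm
  have : Nonempty (Elliptic F) := ⟨α⟩
  choose fix hfix using exists_fixed_of_subsingleton_fixed
    (G := SpecialLinearGroup (Fin 2) F) τ hsub
  have hG : 0 < Nat.card (SpecialLinearGroup (Fin 2) F) := Nat.card_pos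
  have h1 := card_transporter_mul (τ α) β
  -- Let γ = `fix A` be the fixed point of Aτ. If Aτα = β, then inv(β,γ) = inv(Aτα, Aτγ) =
  -- σ(inv(α,γ)). The fibre over such a γ consists of the A taking (τα, τγ) to (β,γ), whose number
  -- does not depend on γ.
  have key := ncard_eq_mul_of_fibers (s := {A : SpecialLinearGroup (Fin 2) F | A • τ α = β})
    (P := {γ | β.inv γ = σ (α.inv γ)})
    (c := Nat.card (SpecialLinearGroup (Fin 2) F) / (Nat.card (Elliptic F) * (Nat.card F + 1)))
    fix (fun A hA => by
      change β.inv (fix A) = σ (α.inv (fix A))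
      have h2 := inv_SL_smul A (τ α) (τ (fix A))
      rwa [show A • τ α = β from hA, hfix, hτ] at h2) (fun γ hγ => by
      have hγα : τ α ≠ τ γ := fun h0 => by
        obtain rfl : α = γ := MulAction.injective _ h0
        rw [Set.mem_ofPred_eq, inv_eq_zero.mpr (rfl : α = α), _root_.map_zero, inv_eq_zero] at hγ
        exact h hγ.symm
      have h2 := card_pair_transporter_mul hγα (α' := β) (β' := γ) (by rw [hτ, hγ])
      have h3 : 0 < Nat.card (Elliptic F) * (Nat.card F + 1) := by
        refine Nat.pos_of_ne_zero fun h3 => ?_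
        rw [h3, zero_mul] at h2
        omega
      rw [← h2, Nat.mul_div_cancel_left _ h3]
      congr 1
      ext A
      constructor
      · rintro ⟨hA, rfl⟩
        exact ⟨hA, hfix A⟩
      · rintro ⟨hA, hA'⟩
        exact ⟨hA, hsub A _ _ (hfix A) hA'⟩)
  obtain ⟨c, hc⟩ : Nat.card (Elliptic F) * (Nat.card F + 1) ∣
      Nat.card (SpecialLinearGroup (Fin 2) F) := ⟨_, (card_pair_transporter_mul h rfl).symm⟩
  have hpos : 0 < Nat.card (Elliptic F) * (Nat.card F + 1) :=
    Nat.mul_pos Nat.card_pos (Nat.succ_pos _)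
  rw [key, hc, Nat.mul_div_cancel_left _ hpos] at h1
  have hc0 : 0 < Nat.card (Elliptic F) * c := by
    refine Nat.pos_of_ne_zero fun h0 => ?_
    rw [mul_right_comm, h0, zero_mul] at hc
    omega
  refine Nat.eq_of_mul_eq_mul_left hc0 ?_
  linarith

end Twisted

end Elliptic

/-! ### Identifying an arbitrary action with the model -/

theorem exists_normal_card_of_odd {G : Type*} [Group G] [Finite G] {m : ℕ} (hm : Odd m)
    (hG : Nat.card G = 2 * m) : ∃ K : Subgroup G, K.Normal ∧ Nat.card K = m := by
  have : Fact (Nat.Prime 2) := ⟨Nat.prime_two⟩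
  let P : Sylow 2 G := default
  have hP : Nat.card P = 2 := by
    have h := P.card_eq_multiplicity
    rw [hG, Nat.factorization_mul (by norm_num) (by rintro rfl; simp at hm),
      Finsupp.add_apply, Nat.Prime.factorization_self Nat.prime_two,
      Nat.factorization_eq_zero_of_not_dvd hm.not_two_dvd_nat] at h
    exact h
  have hc : IsCyclic P := isCyclic_of_prime_card hP
  have h2 : (Nat.card G).minFac = 2 := by
    rw [Nat.minFac_eq_two_iff, hG]
    exact dvd_mul_right _ _
  -- Burnside transfer: a cyclic Sylow subgroup for the smallest prime divisor has a normal
  -- complement.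
  refine ⟨(MonoidHom.transferSylow P (IsCyclic.normalizer_le_centralizer h2 hc)).ker,
    MonoidHom.normal_ker _, ?_⟩
  have h3 := (IsCyclic.isComplement' h2 hc).card_mul_card
  have h4 : Nat.card (P : Subgroup G) = 2 := hP
  rw [h4, hG, mul_comm] at h3
  exact Nat.eq_of_mul_eq_mul_left two_pos h3

section SL

variable {F : Type*} [Field F]

theorem SL_eq_one {A : SpecialLinearGroup (Fin 2) F} {v w : Fin 2 → F} (h : symp v w = 1)
    (hv : A • v = v) (hw : A • w = w) : A = 1 := by
  have hA : ∀ x : Fin 2 → F, A • x = x := fun x => by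
    rw [eq_combination h x, smul_add, smul_comm, smul_comm A, hv, hw]
  have h00 := SL_smul_zero A ![1, 0]
  have h01 := SL_smul_zero A ![0, 1]
  have h10 := SL_smul_one A ![1, 0]
  have h11 := SL_smul_one A ![0, 1]
  rw [hA] at h00 h01 h10 h11
  simp only [cons_val_zero, cons_val_one, mul_one, mul_zero, add_zero, zero_add] at h00 h01 h10 h11
  ext i j
  fin_cases i <;> fin_cases j
  · exact h00.symm
  · exact h01.symm
  · exact h10.symm
  · exact h11.symm

theorem card_SL [Finite F] : Nat.card (SpecialLinearGroup (Fin 2) F) =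
    (Nat.card F ^ 2 - 1) * Nat.card F := by
  have h1 : {p : (Fin 2 → F) × (Fin 2 → F) | symp p.1 p.2 = 1}.ncard =
      Nat.card (SpecialLinearGroup (Fin 2) F) := by
    rw [← Nat.card_coe_set_eq]
    refine Nat.card_congr
      { toFun := fun p => ofPair p.1.1 p.1.2 p.2
        invFun := fun A => ⟨(A • ![1, 0], A • ![0, 1]), by
          rw [Set.mem_ofPred_eq, symp_SL_smul]; simp [symp]⟩
        left_inv := fun p => by
          ext1
          simp [ofPair_smul]
        right_inv := fun A => by
          ext i j
          fin_cases i <;> fin_cases j <;> simp [ofPair, SL_smul_zero, SL_smul_one] }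
  have h2 : {v : Fin 2 → F | v ≠ 0}.ncard = Nat.card F ^ 2 - 1 := by
    have h3 := Set.ncard_compl ({0} : Set (Fin 2 → F))
    rw [Set.ncard_singleton, Nat.card_fun, Nat.card_fin] at h3
    exact h3
  rw [← h1, ← h2]
  refine ncard_eq_mul_of_fibers Prod.fst ?_ ?_
  · rintro ⟨v, w⟩ h rfl
    simp [symp_zero_left] at h
  · intro v hv
    obtain ⟨w, hw⟩ := exists_symp_eq_one hv
    have hinj : Function.Injective fun t : F => (v, t • v + w) := fun s t h =>
      smul_left_injective F hv (add_right_cancel (Prod.mk.inj h).2)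
    rw [← Set.ncard_univ, ← Set.ncard_image_of_injective _ hinj]
    congr 1
    ext ⟨v', x⟩
    constructor
    · rintro ⟨h, h'⟩
      obtain rfl : v' = v := h'
      refine ⟨symp x w, trivial, ?_⟩
      have h3 := eq_combination hw x
      rw [show symp v' x = 1 from h, one_smul] at h3
      exact Prod.ext rfl h3.symm
    · rintro ⟨t, -, h⟩
      obtain ⟨rfl, rfl⟩ := Prod.mk.inj h
      refine ⟨?_, rfl⟩
      change symp v (t • v + w) = 1
      rw [symp_add_right, symp_smul_right, symp_self, hw]
      ring

/-- A is a transvection w ↦ t v + w, and 2t = 0. -/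
theorem sq_eq_one_of_fixed [CharP F 2] {A : SpecialLinearGroup (Fin 2) F} {v : Fin 2 → F}
    (hv : v ≠ 0) (h : A • v = v) : A ^ 2 = 1 := by
  obtain ⟨w, hw⟩ := exists_symp_eq_one hv
  have h1 := eq_combination hw (A • w)
  have h2 : symp v (A • w) = 1 := by
    nth_rewrite 1 [← h]
    rw [symp_SL_smul, hw]
  rw [h2, one_smul] at h1
  refine SL_eq_one hw (by rw [pow_two, mul_smul, h, h]) ?_
  set t := symp (A • w) w
  rw [pow_two, mul_smul, h1, smul_add, smul_comm, h, h1, ← add_assoc, ← add_smul,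
    CharTwo.add_self_eq_zero, zero_smul, zero_add]

variable [Finite F] {m : ℕ}

/-- The order of the eigenvalue divides both m and q - 1, so the eigenvalue is 1. Then A² = 1, while
m is odd. -/
theorem SL_eq_one_of_eigenvector [CharP F 2] (hm : Odd m) (hq : m.Coprime (Nat.card F - 1))
    {A : SpecialLinearGroup (Fin 2) F} (hA : A ^ m = 1) {v : Fin 2 → F} (hv : v ≠ 0) {t : F}
    (h : A • v = t • v) : A = 1 := by
  have hpow : ∀ n : ℕ, (A ^ n) • v = t ^ n • v := fun n => by
    induction n with
    | zero => simp
    | succ n ih => rw [pow_succ, mul_smul, h, smul_comm, ih, smul_smul, pow_succ, mul_comm]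
  have htm : t ^ m = 1 := by
    have h1 := hpow m
    rw [hA, one_smul] at h1
    exact (smul_left_injective F hv (by simpa using h1)).symm
  have ht0 : t ≠ 0 := by
    rintro rfl
    rw [zero_pow (by rintro rfl; simp at hm)] at htm
    exact zero_ne_one htm
  have htq : t ^ (Nat.card F - 1) = 1 := by
    have := Fintype.ofFinite F
    rw [Nat.card_eq_fintype_card]
    exact FiniteField.pow_card_sub_one_eq_one t ht0
  have ht : t = 1 := by
    have h2 := pow_gcd_eq_one.mpr ⟨htm, htq⟩
    rwa [hq, pow_one] at h2
  rw [ht, one_smul] at h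
  have h3 := pow_gcd_eq_one.mpr ⟨hA, sq_eq_one_of_fixed hv h⟩
  rwa [hm.coprime_two_right, pow_one] at h3

/-- If Q has a nonzero isotropic vector u, there is a hyperbolic pair of isotropic vectors u, w, and
Q vanishes only on the lines they span. A permutes these two lines, so A or A² has an eigenvector;
but both are nontrivial of order dividing m. -/
theorem aniso_of_fixed [CharP F 2] (hm : Odd m) (hq : m.Coprime (Nat.card F - 1))
    {A : SpecialLinearGroup (Fin 2) F} (hA : A ^ m = 1) (hA1 : A ≠ 1) {Q : PolarForm F}
    (hQ : (SemidirectProduct.inl A : SemiSL F) • Q = Q) : Q.Aniso := by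
  intro u hu
  by_contra hu0
  have hAQ : ∀ x, Q (A • x) = Q x := fun x => by
    have := Q.smul_apply_smul (SemidirectProduct.inl A) x
    rw [hQ] at this
    exact this
  have hA2 : A ^ 2 ≠ 1 := fun h2 => hA1 (by
    have h3 := pow_gcd_eq_one.mpr ⟨hA, h2⟩
    rwa [hm.coprime_two_right, pow_one] at h3)
  obtain ⟨w', hw'⟩ := exists_symp_eq_one hu0
  obtain ⟨w, hw, hQw⟩ : ∃ w, symp u w = 1 ∧ Q w = 0 := by
    refine ⟨w' + Q w' • u, ?_, ?_⟩
    · rw [symp_add_right, symp_smul_right, symp_self, hw', mul_zero, add_zero]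
    · rw [PolarForm.map_add, PolarForm.map_smul, symp_smul_right, symp_swap, hw', hu]
      ring
  have hw0 : w ≠ 0 := by
    rintro rfl
    simp [symp] at hw
  have hzero : ∀ x, Q x = 0 → (∃ t : F, x = t • u) ∨ ∃ t : F, x = t • w := fun x hx => by
    have h1 := eq_combination hw x
    rw [h1, PolarForm.map_comb, hu, hQw, hw, mul_zero, mul_zero, zero_add, zero_add, mul_one,
      mul_eq_zero] at hx
    rcases hx with hx | hx
    · right
      rw [hx, zero_smul, zero_add] at h1
      exact ⟨_, h1⟩
    · left
      rw [hx, zero_smul, add_zero] at h1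
      exact ⟨_, h1⟩
  rcases hzero (A • u) ((hAQ u).trans hu) with ⟨t, ht⟩ | ⟨t, ht⟩
  · exact hA1 (SL_eq_one_of_eigenvector hm hq hA hu0 ht)
  rcases hzero (A • w) ((hAQ w).trans hQw) with ⟨s, hs⟩ | ⟨s, hs⟩
  · refine hA2 (SL_eq_one_of_eigenvector hm hq (by rw [pow_right_comm, hA, one_pow]) hu0
      (t := t * s) ?_)
    rw [pow_two, mul_smul, ht, smul_comm, hs, smul_smul]
  · exact hA1 (SL_eq_one_of_eigenvector hm hq hA hw0 hs)

end SL

section FixedForm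

variable {F : Type*} [Field F] [CharP F 2]

/-- A group of odd order acting on the affine plane of polar forms has a fixed point. -/
theorem exists_fixed_form {K : Type*} [Group K] [Finite K] (hK : Odd (Nat.card K))
    (f : K →* SemiSL F) : ∃ Q : PolarForm F, ∀ k, f k • Q = Q := by
  have := Fintype.ofFinite K
  let Q₀ : PolarForm F :=
    { toFun := fun x => x 0 * x 1
      map_smul' := fun t x => by simp; ring
      map_add' := fun x y => by
        simp [symp]
        linear_combination (x 1 * y 0) * CharTwo.two_eq_zero (R := F) }
  -- The sum over the orbit has polarization |K| B, which is B because |K| is odd.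
  let Q : PolarForm F :=
    { toFun := fun x => ∑ k : K, (f k • Q₀) x
      map_smul' := fun t x => by
        rw [Finset.mul_sum]
        exact Finset.sum_congr rfl fun k _ => PolarForm.map_smul _ _ _
      map_add' := fun x y => by
        simp_rw [PolarForm.map_add]
        rw [Finset.sum_add_distrib, Finset.sum_add_distrib, Finset.sum_const, Finset.card_univ,
          ← Nat.card_eq_fintype_card, nsmul_eq_mul, natCast_eq_one_of_odd hK, one_mul] }
  refine ⟨Q, fun k => ?_⟩
  ext x
  change (f k).right (∑ k' : K, (f k' • Q₀) ((f k)⁻¹ • x)) = ∑ k' : K, (f k' • Q₀) x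
  rw [map_sum, ← Equiv.sum_comp (Equiv.mulLeft k) fun k' => (f k' • Q₀) x]
  refine Finset.sum_congr rfl fun k' _ => ?_
  rw [Equiv.coe_mulLeft, map_mul, mul_smul, PolarForm.smul_apply (f k) (f k' • Q₀)]

variable [Finite F]

/-- A subgroup of `SL(2, q) ⋊ Aut(F)` of the right order fixes an anisotropic form. -/
theorem exists_aniso_fixed {d : ℕ} (hd : d.Prime) (hd3 : 3 ≤ d) (hF : Nat.card F = 2 ^ d)
    (H : Subgroup (SemiSL F)) (hH : Nat.card H = 2 * ((Nat.card F + 1) * d)) :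
    ∃ Q : PolarForm F, Q.Aniso ∧ ∀ h ∈ H, h • Q = Q := by
  have hdo : Odd d := hd.odd_of_ne_two (by omega)
  have hm : Odd ((Nat.card F + 1) * d) := by
    refine Odd.mul ?_ hdo
    rw [hF]
    exact ((Nat.even_pow.mpr ⟨even_two, by omega⟩)).add_one
  have hq : ((Nat.card F + 1) * d).Coprime (Nat.card F - 1) := by
    have h2 : 2 ≤ 2 ^ d := Nat.le_self_pow (by omega) 2
    refine Nat.Coprime.mul_left ?_ ?_
    · rw [hF]
      have h1 : Nat.Coprime (2 ^ d - 1) 2 := by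
        rw [Nat.coprime_two_right]
        exact Nat.Even.sub_odd (by omega) (Nat.even_pow.mpr ⟨even_two, by omega⟩) odd_one
      have h3 : 2 ^ d + 1 = (2 ^ d - 1) + 2 := by omega
      rw [h3, Nat.coprime_self_add_left]
      exact h1.symm
    -- By Fermat 2^d is 2 modulo d, so d does not divide 2^d - 1.
    · rw [Nat.Prime.coprime_iff_not_dvd hd, hF]
      intro h
      have h1 : 2 ^ d ≡ 2 [MOD d] := by
        have := Fact.mk hd
        rw [← ZMod.natCast_eq_natCast_iff]
        push_cast
        exact ZMod.pow_card _
      have h3 : 2 ^ d ≡ 1 [MOD d] := ((Nat.modEq_iff_dvd' (by omega)).mpr h).symm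
      have h4 : d ∣ 2 - 1 := (Nat.modEq_iff_dvd' (by omega)).mp (h3.symm.trans h1)
      have := Nat.le_of_dvd one_pos h4
      omega
  obtain ⟨K, hKn, hK⟩ := exists_normal_card_of_odd hm hH
  obtain ⟨Q, hQ⟩ := exists_fixed_form (hK ▸ hm) (H.subtype.comp K.subtype)
  obtain ⟨A, hAK, hA1⟩ : ∃ A : SpecialLinearGroup (Fin 2) F,
      (∃ k : K, ((k : H) : SemiSL F) = SemidirectProduct.inl A) ∧ A ≠ 1 := by
    -- K has (q + 1)d elements and Aut(F) only d, so K meets SL(2,F) nontrivially.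
    have hni : ¬ Function.Injective
        ((SemidirectProduct.rightHom (φ := galAction F)).comp (H.subtype.comp K.subtype)) := by
      intro hinj
      have h1 := Nat.card_le_card_of_injective _ hinj
      rw [hK, card_ringAut hF, Nat.succ_mul] at h1
      have := Nat.mul_pos (Nat.card_pos (α := F)) hd.pos
      omega
    rw [injective_iff_map_eq_one] at hni
    push Not at hni
    obtain ⟨k, hk, hk1⟩ := hni
    refine ⟨((k : H) : SemiSL F).left, ⟨k, SemidirectProduct.ext rfl hk⟩, fun h => hk1 ?_⟩
    exact Subtype.ext (Subtype.ext (SemidirectProduct.ext h hk))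
  obtain ⟨k, hk⟩ := hAK
  have hAm : A ^ ((Nat.card F + 1) * d) = 1 := by
    have h1 : k ^ ((Nat.card F + 1) * d) = 1 := by rw [← hK]; exact pow_card_eq_one'
    have h2 := congrArg (fun k : K => ((k : H) : SemiSL F)) h1
    simp only [Subgroup.coe_pow, hk, ← map_pow, Subgroup.coe_one] at h2
    exact SemidirectProduct.inl_injective h2
  have hAQ : (SemidirectProduct.inl A : SemiSL F) • Q = Q := hk ▸ hQ k
  refine ⟨Q, aniso_of_fixed hm hq hAm hA1 hAQ, fun h hh => ?_⟩
  -- A conjugate of A by h again lies in K and fixes Q, so A fixes h • Q. The displacement from Q to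
  -- h • Q is then fixed by A, hence zero, as A has no eigenvectors.
  have hfix : (SemidirectProduct.inl A : SemiSL F) • h • Q = h • Q := by
    have h1 := hQ (⟨_, hKn.conj_mem k k.2 (⟨h, hh⟩ : H)⁻¹⟩)
    simp only [MonoidHom.comp_apply, Subgroup.coe_subtype, Subgroup.coe_mul, inv_inv,
      Subgroup.coe_inv, hk, mul_smul, inv_smul_eq_iff] at h1
    exact h1
  obtain ⟨v, hv⟩ := Q.exists_twist_eq (h • Q)
  rw [← hv, PolarForm.smul_twist, hAQ] at hfix
  have h1 := Q.twist_injective hfix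
  rw [inl_smul] at h1
  by_cases hv0 : v = 0
  · rw [← hv, hv0, PolarForm.twist_zero]
  · exact absurd (SL_eq_one_of_eigenvector hm hq hAm hv0 (t := 1) (by rw [one_smul]; exact h1)) hA1

/-- Every transitive action of degree `q (q - 1) / 2` is isomorphic to the action on anisotropic
forms. -/
theorem exists_equivariant_bijection {d : ℕ} (hd : d.Prime) (hd3 : 3 ≤ d)
    (hF : Nat.card F = 2 ^ d) {Ω : Type*} [Finite Ω] [MulAction (SemiSL F) Ω]
    [MulAction.IsPretransitive (SemiSL F) Ω]
    (hΩ : 2 * Nat.card Ω = Nat.card F * (Nat.card F - 1)) :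
    ∃ ι : Ω → Elliptic F, Function.Bijective ι ∧ ∀ (s : SemiSL F) α, ι (s • α) = s • ι α := by
  have hq : 1 < Nat.card F := Finite.one_lt_card
  have hpos : 0 < Nat.card F * (Nat.card F - 1) := Nat.mul_pos (by omega) (by omega)
  have hne : Nonempty Ω := (Nat.card_pos_iff.mp (by omega)).1
  obtain ⟨α⟩ := hne
  have hH : Nat.card (MulAction.stabilizer (SemiSL F) α) = 2 * ((Nat.card F + 1) * d) := by
    have h1 := card_orbit_mul_card_transporter (MulAction.mem_orbit_self (M := SemiSL F) α)
    rw [MulAction.orbit_eq_univ, Set.ncard_univ, SemidirectProduct.card, card_SL,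
      card_ringAut hF] at h1
    change Nat.card Ω * (MulAction.stabilizer (SemiSL F) α : Set (SemiSL F)).ncard = _ at h1
    rw [← Nat.card_coe_set_eq] at h1
    refine Nat.eq_of_mul_eq_mul_left hpos ?_
    rw [← hΩ, mul_assoc, show Nat.card Ω * Nat.card (MulAction.stabilizer (SemiSL F) α) = _ from h1,
      hΩ]
    obtain ⟨n, hn⟩ : ∃ n, Nat.card F = n + 1 := ⟨Nat.card F - 1, by omega⟩
    rw [hn, show (n + 1) ^ 2 - 1 = n * (n + 2) by
      rw [Nat.sub_eq_iff_eq_add (Nat.one_le_pow _ _ (by omega))]; ring, Nat.add_sub_cancel]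
    ring
  obtain ⟨Q, hQ, hfix⟩ := exists_aniso_fixed hd hd3 hF _ hH
  choose s hs using fun β => MulAction.exists_smul_eq (SemiSL F) α β
  let Q' : Elliptic F := ⟨Q, hQ⟩
  -- The map t α ↦ t Q' is well defined because the stabilizer of α fixes Q'.
  have hι : ∀ t : SemiSL F, s (t • α) • Q' = t • Q' := fun t => by
    have h1 : t⁻¹ * s (t • α) ∈ MulAction.stabilizer (SemiSL F) α := by
      rw [MulAction.mem_stabilizer_iff, mul_smul, hs, inv_smul_smul]
    have h2 : (t⁻¹ * s (t • α)) • Q' = Q' := Subtype.ext (hfix _ h1)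
    rwa [mul_smul, inv_smul_eq_iff] at h2
  refine ⟨fun β => s β • Q', ?_, fun t β => ?_⟩
  · refine Function.Surjective.bijective_of_nat_card_le (fun R => ?_) ?_
    · obtain ⟨A, hA⟩ := MulAction.exists_smul_eq (SpecialLinearGroup (Fin 2) F) Q' R
      exact ⟨(SemidirectProduct.inl A : SemiSL F) • α, (hι _).trans hA⟩
    · have := Elliptic.two_mul_card Q'
      omega
  · change s (t • β) • Q' = t • s β • Q'
    rw [← hs β, smul_smul, hι, hs, mul_smul]

end FixedForm

/-! ### Counts summed over the Galois group -/

namespace Elliptic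

variable {F : Type*} [Field F] [CharP F 2] [Finite F] {d : ℕ} (hd : d.Prime) (hd3 : 3 ≤ d)
  (hF : Nat.card F = 2 ^ d)

include hd hd3 hF

theorem ncard_exists_inv_eq (α : Elliptic F) {e : F} (he : e ∈ (artinSchreier F).range)
    (he0 : e ≠ 0) :
    {γ | ∃ σ : F ≃+* F, α.inv γ = σ e}.ncard = d * (Nat.card F + 1) := by
  have hinj : Function.Injective fun σ : F ≃+* F => σ e := fun σ τ h => by
    by_contra hne
    refine map_ne_self hd hd3 hF (σ := τ⁻¹ * σ) (fun h1 => hne (inv_mul_eq_one.mp h1).symm)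
      he he0 ?_
    rw [RingAut.mul_apply, show σ e = τ e from h, ← RingAut.mul_apply, inv_mul_cancel,
      RingAut.one_apply]
  rw [← card_ringAut hF, ← Set.ncard_univ, ← Set.ncard_image_of_injective _ hinj]
  refine ncard_eq_mul_of_fibers (fun γ => α.inv γ) ?_ ?_
  · rintro γ ⟨σ, hσ⟩
    exact ⟨σ, trivial, hσ.symm⟩
  · rintro _ ⟨σ, -, rfl⟩
    rw [← ncard_inv_eq α (e := σ e) ((map_mem_artinSchreier_iff σ).mpr he) (by simpa using he0)]
    congr 1
    ext γ
    exact ⟨fun h => h.2, fun h => ⟨⟨σ, h⟩, h⟩⟩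

/-- Different σ have disjoint solution sets: two automorphisms agreeing on inv(α,γ) would be equal
or force γ = α, whence β = α. So the counts add up to q + (d - 1)(q + 1). -/
theorem ncard_exists_inv_eq_map_inv {α β : Elliptic F} (h : α ≠ β) :
    {γ | ∃ σ : F ≃+* F, β.inv γ = σ (α.inv γ)}.ncard + 1 = d * (Nat.card F + 1) := by
  classical
  have huniq : ∀ (γ : Elliptic F) (σ τ : F ≃+* F), β.inv γ = σ (α.inv γ) →
      β.inv γ = τ (α.inv γ) → σ = τ := fun γ σ τ hσ hτ => by
    by_contra hne
    refine map_ne_self hd hd3 hF (σ := τ⁻¹ * σ) (fun h1 => hne (inv_mul_eq_one.mp h1).symm)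
      (α.inv_mem γ) (fun h0 => ?_) ?_
    · obtain rfl := inv_eq_zero.mp h0
      rw [h0, map_zero, inv_eq_zero] at hσ
      exact h hσ.symm
    · rw [RingAut.mul_apply, ← hσ, hτ, ← RingAut.mul_apply, inv_mul_cancel, RingAut.one_apply]
  have hsplit : {γ | ∃ σ : F ≃+* F, β.inv γ = σ (α.inv γ)} =
      {γ | β.inv γ = α.inv γ} ∪ {γ | ∃ σ : F ≃+* F, σ ≠ 1 ∧ β.inv γ = σ (α.inv γ)} := by
    ext γ
    constructor
    · rintro ⟨σ, hσ⟩
      by_cases h1 : σ = 1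
      · subst h1
        exact Or.inl hσ
      · exact Or.inr ⟨σ, h1, hσ⟩
    · rintro (h1 | ⟨σ, -, hσ⟩)
      · exact ⟨1, h1⟩
      · exact ⟨σ, hσ⟩
  let f : Elliptic F → (F ≃+* F) := fun γ =>
    if hγ : ∃ σ : F ≃+* F, β.inv γ = σ (α.inv γ) then hγ.choose else 1
  have hf : ∀ γ (σ : F ≃+* F), β.inv γ = σ (α.inv γ) → f γ = σ := fun γ σ hσ => by
    have hγ : ∃ σ : F ≃+* F, β.inv γ = σ (α.inv γ) := ⟨σ, hσ⟩
    refine huniq γ _ _ ?_ hσ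
    rw [show f γ = hγ.choose from dif_pos hγ]
    exact hγ.choose_spec
  have h2 : {γ | ∃ σ : F ≃+* F, σ ≠ 1 ∧ β.inv γ = σ (α.inv γ)}.ncard =
      ({1}ᶜ : Set (F ≃+* F)).ncard * (Nat.card F + 1) := by
    refine ncard_eq_mul_of_fibers f ?_ ?_
    · rintro γ ⟨σ, h1, hσ⟩
      rw [hf γ σ hσ]
      exact h1
    · intro σ h1
      rw [← ncard_inv_eq_map_inv hd hd3 hF h (σ := σ) h1]
      congr 1
      ext γ
      constructor
      · rintro ⟨⟨τ, -, hτ⟩, h3⟩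
        rw [hf γ τ hτ] at h3
        rw [← h3]
        exact hτ
      · intro hσ
        exact ⟨⟨σ, h1, hσ⟩, hf γ σ hσ⟩
  rw [hsplit, Set.ncard_union_eq, h2, ncard_inv_eq_inv h, Set.ncard_compl, Set.ncard_singleton,
    card_ringAut hF]
  · obtain ⟨n, rfl⟩ : ∃ n, d = n + 1 := ⟨d - 1, by omega⟩
    rw [Nat.add_sub_cancel]
    ring
  · rw [Set.disjoint_left]
    rintro γ h1 ⟨σ, h3, hσ⟩
    exact h3 (huniq γ σ 1 hσ h1)

omit hd hd3 in
theorem ncard_exists_inter_le {α β : Elliptic F} (h : α ≠ β) (e e' : F) :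
    {γ | (∃ σ : F ≃+* F, α.inv γ = σ e) ∧ ∃ τ : F ≃+* F, β.inv γ = τ e'}.ncard ≤ 4 * d ^ 2 := by
  have := Fintype.ofFinite (F ≃+* F)
  have h1 : {γ | (∃ σ : F ≃+* F, α.inv γ = σ e) ∧ ∃ τ : F ≃+* F, β.inv γ = τ e'} =
      ⋃ p : (F ≃+* F) × (F ≃+* F), {γ | α.inv γ = p.1 e ∧ β.inv γ = p.2 e'} := by
    ext γ
    simp only [Set.mem_ofPred_eq, Set.mem_iUnion, Prod.exists]
    tauto
  rw [h1]
  refine (Set.ncard_iUnion_le_of_fintype _).trans ?_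
  refine (Finset.sum_le_card_nsmul _ _ 4 fun p _ => ncard_inter_le h _ _).trans ?_
  rw [Finset.card_univ, Fintype.card_prod, ← Nat.card_eq_fintype_card, card_ringAut hF,
    smul_eq_mul]
  exact le_of_eq (by ring)

end Elliptic

end Hollmann

/-! ### General facts on coherent configurations -/

namespace CoherentConfiguration

variable {Ω : Type*} [Finite Ω] (X : CoherentConfiguration Ω)

theorem eq_of_mem {r s : X.BasisRel} {p : Ω × Ω} (hr : p ∈ (r : Set (Ω × Ω)))
    (hs : p ∈ (s : Set (Ω × Ω))) : r = s :=
  Subtype.ext ((X.isPartition.2 p).unique ⟨r.2, hr⟩ ⟨s.2, hs⟩)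

/-- Each γ contributes to exactly one summand, that of the relation containing (α,γ). -/
theorem indistNum_eq (s : X.BasisRel) {α β : Ω} (h : (α, β) ∈ (s : Set (Ω × Ω))) :
    X.indistNum s =
      {γ : Ω | ∃ r : X.BasisRel, (α, γ) ∈ (r : Set (Ω × Ω)) ∧ (β, γ) ∈ (r : Set (Ω × Ω))}.ncard := by
  classical
  have := Fintype.ofFinite Ω
  have := Fintype.ofFinite X.BasisRel
  rw [indistNum, finsum_eq_sum_of_fintype]
  choose f hf using fun γ : Ω => (X.isPartition.2 (α, γ)).exists
  let f' : Ω → X.BasisRel := fun γ => ⟨f γ, (hf γ).1⟩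
  rw [Set.ncard_eq_toFinset_card', Finset.card_eq_sum_card_fiberwise (f := f')
    (t := Finset.univ) (fun _ _ => Finset.mem_coe.mpr (Finset.mem_univ _))]
  refine Finset.sum_congr rfl fun r _ => ?_
  rw [X.interNum_eq r _ s h, Set.ncard_eq_toFinset_card']
  congr 1
  ext γ
  simp only [Set.mem_toFinset, Finset.mem_filter, Set.mem_ofPred_eq]
  constructor
  · rintro ⟨h1, h2⟩
    exact ⟨⟨r, h1, h2⟩, X.eq_of_mem (hf γ).2 h1⟩
  · rintro ⟨⟨r', h1, h2⟩, h3⟩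
    obtain rfl : r' = r := (X.eq_of_mem h1 (hf γ).2).trans h3
    exact ⟨h1, h2⟩

section Perm

variable {S : Type*} [Group S] [MulAction S Ω]

/-- A group of permutations of the points that permutes the basis relations acts on them. -/
def permHom (hX : ∀ (s : S), ∀ r ∈ X.rels, {p : Ω × Ω | s⁻¹ • p ∈ r} ∈ X.rels) :
    S →* Equiv.Perm X.BasisRel where
  toFun s :=
    { toFun := fun r => ⟨{p | s⁻¹ • p ∈ (r : Set (Ω × Ω))}, hX s r r.2⟩
      invFun := fun r => ⟨{p | s⁻¹⁻¹ • p ∈ (r : Set (Ω × Ω))}, hX s⁻¹ r r.2⟩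
      left_inv := fun r => by ext p; simp
      right_inv := fun r => by ext p; simp }
  map_one' := by ext r p; simp
  map_mul' s t := by ext r p; simp [mul_smul]

theorem mem_permHom (hX : ∀ (s : S), ∀ r ∈ X.rels, {p : Ω × Ω | s⁻¹ • p ∈ r} ∈ X.rels) (s : S)
    (r : X.BasisRel) (p : Ω × Ω) :
    p ∈ (X.permHom hX s r : Set (Ω × Ω)) ↔ s⁻¹ • p ∈ (r : Set (Ω × Ω)) := Iff.rfl

theorem permHom_mem_algAut (hX : ∀ (s : S), ∀ r ∈ X.rels, {p : Ω × Ω | s⁻¹ • p ∈ r} ∈ X.rels)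
    (g : S) : X.permHom hX g ∈ X.algAut := by
  intro r s t
  have h1 : (g • (X.rep t).1, g • (X.rep t).2) ∈ (X.permHom hX g t : Set (Ω × Ω)) := by
    rw [mem_permHom]
    change g⁻¹ • g • X.rep t ∈ _
    rw [inv_smul_smul]
    exact X.rep_mem t
  rw [X.interNum_eq _ _ _ h1, interNum, ← Set.ncard_image_of_injective _ (MulAction.injective g⁻¹)]
  congr 1
  ext γ
  simp only [mem_permHom, Prod.smul_mk, inv_smul_smul]
  constructor
  · rintro ⟨δ, hδ, rfl⟩
    exact hδ
  · intro hγ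
    refine ⟨g • γ, ?_, inv_smul_smul g γ⟩
    rw [Set.mem_ofPred_eq, inv_smul_smul]
    exact hγ

end Perm

end CoherentConfiguration

namespace Hollmann

/-! ### From the semilinear group to PΓL(2,q) -/

section Projective

variable {F : Type*} [Field F]

/-- The semilinear map induced by an element of `SL(2, F) ⋊ Aut(F)`. -/
def semiMap (s : SemiSL F) : (Fin 2 → F) →ₛₗ[(s.right : F →+* F)] (Fin 2 → F) where
  toFun v := s • v
  map_add' := smul_add s
  map_smul' := semi_smul_smul s

theorem semiMap_injective (s : SemiSL F) : Function.Injective (semiMap s) :=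
  MulAction.injective s

/-- The permutation of the projective line induced by an element of `SL(2, F) ⋊ Aut(F)`. -/
def semiPerm (s : SemiSL F) : Equiv.Perm (ℙ F (Fin 2 → F)) where
  toFun := Projectivization.map (semiMap s) (semiMap_injective s)
  invFun := Projectivization.map (semiMap s⁻¹) (semiMap_injective s⁻¹)
  left_inv x := by
    induction x using Projectivization.ind with
    | h v hv =>
      change Projectivization.mk F (s⁻¹ • s • v) _ = _
      simp only [inv_smul_smul]
  right_inv x := by
    induction x using Projectivization.ind with
    | h v hv =>
      change Projectivization.mk F (s • s⁻¹ • v) _ = _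
      simp only [smul_inv_smul]

theorem semiPerm_mk (s : SemiSL F) (v : Fin 2 → F) (hv : v ≠ 0) :
    semiPerm s (Projectivization.mk F v hv) =
      Projectivization.mk F (s • v) ((smul_ne_zero_iff_ne s).mpr hv) := rfl

variable (F) in
/-- The action of `SL(2, F) ⋊ Aut(F)` on the projective line. -/
def toPGammaL : SemiSL F →* PGammaL F where
  toFun s := ⟨semiPerm s, s.right, DistribMulAction.toAddEquiv _ s, semi_smul_smul s,
    fun _ _ => rfl⟩
  map_one' := by
    ext x
    induction x using Projectivization.ind with
    | h v hv => simp [semiPerm_mk]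
  map_mul' s t := by
    ext x
    induction x using Projectivization.ind with
    | h v hv => simp [semiPerm_mk, mul_smul]

theorem range_toPGammaL_inl :
    ((toPGammaL F).comp SemidirectProduct.inl).range = PSLSubgroup F := by
  have key : ∀ A : SpecialLinearGroup (Fin 2) F,
      semiPerm (SemidirectProduct.inl A) = MulAction.toPermHom
        (ProjectiveSpecialLinearGroup (Fin 2) F) (ℙ F (Fin 2 → F)) (QuotientGroup.mk A) := by
    intro A
    ext x
    induction x using Projectivization.ind with
    | h v hv => rfl
  ext f
  rw [PSLSubgroup, Subgroup.mem_subgroupOf]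
  constructor
  · rintro ⟨A, rfl⟩
    exact ⟨QuotientGroup.mk A, (key A).symm⟩
  · rintro ⟨A, hA⟩
    obtain ⟨A, rfl⟩ := QuotientGroup.mk_surjective A
    exact ⟨A, Subtype.ext ((key A).trans hA)⟩

/-- Scalars act trivially on the projective line, so the semilinear map may be multiplied by c with
c² the inverse of its determinant, which puts its linear part into SL(2,F). -/
theorem toPGammaL_surjective [CharP F 2] [Finite F] : Function.Surjective (toPGammaL F) := by
  rintro ⟨f, σ, g, hg, hf⟩
  have hv : ∀ v : Fin 2 → F, g v = σ (v 0) • g ![1, 0] + σ (v 1) • g ![0, 1] := fun v => by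
    rw [← hg, ← hg, ← map_add]
    congr 1
    funext i
    fin_cases i <;> simp
  have hne : symp (g ![1, 0]) (g ![0, 1]) ≠ 0 := by
    intro h0
    have hu : g ![1, 0] ≠ 0 := (map_ne_zero_iff g g.injective).mpr fun h => by
      simpa using congrFun h 0
    obtain ⟨w, hw⟩ := exists_symp_eq_one hu
    have h1 := eq_combination hw (g ![0, 1])
    rw [h0, zero_smul, add_zero] at h1
    rw [← σ.apply_symm_apply (symp _ w), ← hg] at h1
    have h2 := congrFun (g.injective h1) 1
    simp at h2
  obtain ⟨c, hc⟩ := (Finite.injective_iff_surjective.mp (fun a b => CharTwo.sq_inj.mp) :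
      Function.Surjective fun x : F => x ^ 2) (symp (g ![1, 0]) (g ![0, 1]))⁻¹
  have hc2 : c ^ 2 = (symp (g ![1, 0]) (g ![0, 1]))⁻¹ := hc
  have hc0 : c ≠ 0 := by
    rintro rfl
    rw [zero_pow two_ne_zero] at hc2
    exact inv_ne_zero hne hc2.symm
  have hs : symp (c • g ![1, 0]) (c • g ![0, 1]) = 1 := by
    rw [symp_smul_left, symp_smul_right, ← mul_assoc, ← pow_two, hc2, inv_mul_cancel₀ hne]
  refine ⟨⟨ofPair _ _ hs, σ⟩, Subtype.ext ?_⟩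
  ext x
  induction x using Projectivization.ind with
  | h v hv0 =>
    change semiPerm _ _ = f _
    rw [hf, semiPerm_mk, Projectivization.mk_eq_mk_iff']
    refine ⟨c, ?_⟩
    rw [semi_smul_def, ofPair_smul, hv, smul_add, smul_comm c, smul_comm c]

end Projective

theorem mem_basisRel_iff {G Ω : Type*} [Group G] [Finite Ω] [MulAction G Ω]
    (r : (orbitalConfiguration G Ω).BasisRel) {p q : Ω × Ω} (hp : p ∈ (r : Set (Ω × Ω))) :
    q ∈ (r : Set (Ω × Ω)) ↔ q ∈ MulAction.orbit G p := by
  obtain ⟨_, p', rfl⟩ := r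
  change p ∈ MulAction.orbit G p' at hp
  rw [MulAction.orbit_eq_iff.mpr hp]

theorem ncard_comp {α β : Type*} {f : α → β} (hf : Function.Bijective f) (p : β → Prop) :
    {a | p (f a)}.ncard = {b | p b}.ncard :=
  Set.ncard_preimage_of_injective_subset_range hf.1 fun b _ => hf.2 b

/-! ### Orbits on pairs in terms of the invariant -/

section Orbitals

variable {F : Type*} [Field F] [CharP F 2] [Finite F] {Ω : Type*} [MulAction (PGammaL F) Ω]
  {ι : Ω → Elliptic F} (hι : Function.Injective ι)
  (hsmul : ∀ (s : SemiSL F) α, ι (toPGammaL F s • α) = s • ι α)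

include hι hsmul

theorem mem_orbit_PSL_iff (p q : Ω × Ω) :
    q ∈ MulAction.orbit (PSLSubgroup F) p ↔ (ι q.1).inv (ι q.2) = (ι p.1).inv (ι p.2) := by
  constructor
  · rintro ⟨⟨g, hg⟩, rfl⟩
    rw [← range_toPGammaL_inl] at hg
    obtain ⟨A, rfl⟩ := hg
    change (ι (toPGammaL F (SemidirectProduct.inl A) • p.1)).inv
      (ι (toPGammaL F (SemidirectProduct.inl A) • p.2)) = _
    rw [hsmul, hsmul, Elliptic.inv_smul]
    rfl
  · intro h
    obtain ⟨A, h1, h2⟩ := Elliptic.exists_SL_smul _ _ _ _ h.symm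
    refine ⟨⟨toPGammaL F (SemidirectProduct.inl A), ?_⟩, Prod.ext (hι ?_) (hι ?_)⟩
    · rw [← range_toPGammaL_inl]
      exact ⟨A, rfl⟩
    · exact (hsmul _ _).trans h1
    · exact (hsmul _ _).trans h2

theorem mem_orbit_PGammaL_iff (p q : Ω × Ω) :
    q ∈ MulAction.orbit (PGammaL F) p ↔
      ∃ σ : F ≃+* F, (ι q.1).inv (ι q.2) = σ ((ι p.1).inv (ι p.2)) := by
  constructor
  · rintro ⟨g, rfl⟩
    obtain ⟨s, rfl⟩ := toPGammaL_surjective g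
    refine ⟨s.right, ?_⟩
    change (ι (toPGammaL F s • p.1)).inv (ι (toPGammaL F s • p.2)) = _
    rw [hsmul, hsmul, Elliptic.inv_smul]
  · rintro ⟨σ, h⟩
    have h3 : (ι (toPGammaL F (SemidirectProduct.inr σ) • p.1)).inv
        (ι (toPGammaL F (SemidirectProduct.inr σ) • p.2)) = (ι q.1).inv (ι q.2) := by
      rw [hsmul, hsmul, Elliptic.inv_smul, h]
      rfl
    have h4 := (mem_orbit_PSL_iff hι hsmul (toPGammaL F (SemidirectProduct.inr σ) • p) q).mpr h3.symm
    obtain ⟨g, rfl⟩ := h4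
    exact ⟨g * toPGammaL F (SemidirectProduct.inr σ), mul_smul _ _ _⟩

end Orbitals

/-! ### The three assertions for the Hollmann schemes -/

section Scheme

variable {F : Type*} [Field F] [CharP F 2] [Finite F] {Ω : Type*} [Finite Ω]
  [MulAction (PGammaL F) Ω] {ι : Ω → Elliptic F} (hι : Function.Bijective ι)
  (hsmul : ∀ (s : SemiSL F) α, ι (toPGammaL F s • α) = s • ι α)
  {d : ℕ} (hd : d.Prime) (hd3 : 3 ≤ d) (hF : Nat.card F = 2 ^ d)

include hι hsmul

theorem mem_small_iff (r : (smallHollmann F Ω).BasisRel) {α β γ δ : Ω}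
    (h : (α, β) ∈ (r : Set (Ω × Ω))) :
    (γ, δ) ∈ (r : Set (Ω × Ω)) ↔ ∃ σ : F ≃+* F, (ι γ).inv (ι δ) = σ ((ι α).inv (ι β)) :=
  (mem_basisRel_iff r h).trans (mem_orbit_PGammaL_iff hι.1 hsmul _ _)

theorem small_isScheme [Nonempty Ω] : (smallHollmann F Ω).IsScheme := by
  obtain ⟨α⟩ := ‹Nonempty Ω›
  refine ⟨(α, α), ?_⟩
  ext ⟨γ, δ⟩
  rw [mem_orbit_PGammaL_iff hι.1 hsmul, Elliptic.inv_eq_zero.mpr (rfl : ι α = ι α)]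
  simp only [map_zero, exists_const, Elliptic.inv_eq_zero, hι.1.eq_iff]
  rfl

include hF in
theorem small_maxInterNum_le (t : (smallHollmann F Ω).BasisRel)
    (ht : (smallHollmann F Ω).IsIrreflexive t) :
    (smallHollmann F Ω).maxInterNum t ≤ 4 * d ^ 2 := by
  refine ciSup_le' ?_
  rintro ⟨r, s⟩
  obtain ⟨⟨α, β⟩, hp⟩ := CoherentConfiguration.basisRel_nonempty t
  obtain ⟨⟨γ, δ⟩, hr⟩ := CoherentConfiguration.basisRel_nonempty r
  obtain ⟨⟨γ', δ'⟩, hs⟩ := CoherentConfiguration.basisRel_nonempty s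
  have hne : ι α ≠ ι β := fun h => by
    obtain rfl := hι.1 h
    exact ht α hp
  change (smallHollmann F Ω).interNum r s t ≤ _
  rw [CoherentConfiguration.interNum_eq _ _ _ _ hp]
  simp only [mem_small_iff hι hsmul r hr, mem_small_iff hι hsmul s hs]
  have h1 := ncard_comp hι fun x => (∃ σ : F ≃+* F, (ι α).inv x = σ ((ι γ).inv (ι δ))) ∧
    ∃ τ : F ≃+* F, x.inv (ι β) = τ ((ι γ').inv (ι δ'))
  rw [h1]
  simp only [fun x : Elliptic F => Elliptic.inv_swap (ι β) x]
  exact Elliptic.ncard_exists_inter_le hF hne _ _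

include hd hd3 hF

theorem small_isPseudocyclic [Nonempty Ω] :
    (smallHollmann F Ω).IsPseudocyclic (d * (Nat.card F + 1)) := by
  refine ⟨small_isScheme hι hsmul, fun s hs => ?_⟩
  obtain ⟨⟨α, β⟩, hp⟩ := CoherentConfiguration.basisRel_nonempty s
  have hne : ι α ≠ ι β := fun h => by
    obtain rfl := hι.1 h
    exact hs α hp
  constructor
  · rw [CoherentConfiguration.indistNum_eq _ s hp,
      ← Elliptic.ncard_exists_inv_eq_map_inv hd hd3 hF hne]
    congr 1
    rw [← ncard_comp hι]
    congr 1
    ext γ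
    constructor
    · rintro ⟨r, h1, h2⟩
      exact (mem_small_iff hι hsmul r h1).mp h2
    · intro h
      let r : (smallHollmann F Ω).BasisRel := ⟨_, (α, γ), rfl⟩
      have hr : (α, γ) ∈ (r : Set (Ω × Ω)) := MulAction.mem_orbit_self _
      exact ⟨r, hr, (mem_small_iff hι hsmul r hr).mpr h⟩
  · rw [CoherentConfiguration.valency_eq _ s hp,
      ← Elliptic.ncard_exists_inv_eq hd hd3 hF (ι α) (Elliptic.inv_mem (ι α) (ι β))
        (fun h => hne (Elliptic.inv_eq_zero.mp h)), ← ncard_comp hι]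
    simp only [mem_small_iff hι hsmul s hp]

theorem exists_fusion [Nontrivial Ω] :
    ∃ Φ : Subgroup (Equiv.Perm (largeHollmann F Ω).BasisRel),
      Nat.card Φ = d ∧ IsAlgebraicFusion (smallHollmann F Ω) (largeHollmann F Ω) Φ := by
  let _ : MulAction (F ≃+* F) Ω :=
    MulAction.compHom Ω ((toPGammaL F).comp SemidirectProduct.inr)
  have hinv : ∀ (σ : F ≃+* F) (p : Ω × Ω),
      (ι (σ • p).1).inv (ι (σ • p).2) = σ ((ι p.1).inv (ι p.2)) := fun σ p => by
    change (ι (toPGammaL F (SemidirectProduct.inr σ) • p.1)).inv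
      (ι (toPGammaL F (SemidirectProduct.inr σ) • p.2)) = _
    rw [hsmul, hsmul, Elliptic.inv_smul]
    rfl
  have hinv' : ∀ (σ : F ≃+* F) (p q : Ω × Ω),
      σ⁻¹ • q ∈ MulAction.orbit (PSLSubgroup F) p ↔
        (ι q.1).inv (ι q.2) = σ ((ι p.1).inv (ι p.2)) := fun σ p q => by
    rw [mem_orbit_PSL_iff hι.1 hsmul, hinv]
    exact RingEquiv.symm_apply_eq σ
  have hX : ∀ (σ : F ≃+* F), ∀ r ∈ (largeHollmann F Ω).rels,
      {p : Ω × Ω | σ⁻¹ • p ∈ r} ∈ (largeHollmann F Ω).rels := by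
    rintro σ _ ⟨p, rfl⟩
    refine ⟨σ • p, ?_⟩
    ext q
    rw [Set.mem_ofPred_eq, hinv', mem_orbit_PSL_iff hι.1 hsmul, hinv]
  let θ := (largeHollmann F Ω).permHom hX
  have hθ : ∀ (σ : F ≃+* F) (r : (largeHollmann F Ω).BasisRel) {p : Ω × Ω}, p ∈ (r : Set (Ω × Ω)) →
      ∀ q, q ∈ (θ σ r : Set (Ω × Ω)) ↔ (ι q.1).inv (ι q.2) = σ ((ι p.1).inv (ι p.2)) :=
    fun σ r p hp q => by
      rw [CoherentConfiguration.mem_permHom, mem_basisRel_iff r hp, hinv']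
  have hrel : ∀ p : Ω × Ω, ∃ r : (largeHollmann F Ω).BasisRel, p ∈ (r : Set (Ω × Ω)) :=
    fun p => ⟨⟨_, p, rfl⟩, MulAction.mem_orbit_self _⟩
  -- An automorphism acting trivially on the relations would fix the nonzero invariant of a pair of
  -- distinct points.
  have hinj : Function.Injective θ := by
    rw [injective_iff_map_eq_one]
    intro σ hσ
    by_contra hne
    obtain ⟨α, β, hαβ⟩ := exists_pair_ne Ω
    obtain ⟨r, hr⟩ := hrel (α, β)
    have h1 := (hθ σ r hr (α, β)).mp (by rw [hσ]; exact hr)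
    exact map_ne_self hd hd3 hF hne (Elliptic.inv_mem _ _)
      (fun h0 => hαβ (hι.1 (Elliptic.inv_eq_zero.mp h0))) h1.symm
  have hunion : ∀ (r : (largeHollmann F Ω).BasisRel) {p : Ω × Ω}, p ∈ (r : Set (Ω × Ω)) →
      ⋃ φ ∈ θ.range, (φ r : Set (Ω × Ω)) = MulAction.orbit (PGammaL F) p := fun r p hp => by
    ext q
    rw [mem_orbit_PGammaL_iff hι.1 hsmul]
    simp only [Set.mem_iUnion, MonoidHom.mem_range, exists_prop, exists_exists_eq_and,
      hθ _ r hp]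
  refine ⟨θ.range, ?_, ?_, ?_⟩
  · rw [← card_ringAut hF]
    exact (Nat.card_congr (MonoidHom.ofInjective hinj).toEquiv).symm
  · rintro _ ⟨σ, rfl⟩
    exact CoherentConfiguration.permHom_mem_algAut _ hX σ
  · ext s
    constructor
    · rintro ⟨p, rfl⟩
      obtain ⟨r, hr⟩ := hrel p
      exact ⟨r, hunion r hr⟩
    · rintro ⟨r, rfl⟩
      obtain ⟨p, hp⟩ := CoherentConfiguration.basisRel_nonempty r
      exact ⟨p, (hunion r hp).symm⟩

end Scheme

end Hollmann

/-! ### Transfer to the given action -/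

theorem proposition5p2 (d : ℕ) (hd : d.Prime) (hd3 : 3 ≤ d)
    (F : Type*) [Field F] [Finite F] (hF : Nat.card F = 2 ^ d)
    (Ω : Type*) [Finite Ω] [MulAction (PGammaL F) Ω] [FaithfulSMul (PGammaL F) Ω]
    [MulAction.IsPretransitive (PGammaL F) Ω]
    (hΩ : Nat.card Ω = 2 ^ d * (2 ^ d - 1) / 2) :
    (∃ Φ : Subgroup (Equiv.Perm (largeHollmann F Ω).BasisRel),
      Nat.card Φ = d ∧ IsAlgebraicFusion (smallHollmann F Ω) (largeHollmann F Ω) Φ) ∧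
    (smallHollmann F Ω).IsPseudocyclic (d * (2 ^ d + 1)) ∧
    ∀ t : (smallHollmann F Ω).BasisRel, (smallHollmann F Ω).IsIrreflexive t →
      (smallHollmann F Ω).maxInterNum t ≤ 4 * d ^ 2 := by
  have := Hollmann.charP_two hF
  let _ : MulAction (Hollmann.SemiSL F) Ω := MulAction.compHom Ω (Hollmann.toPGammaL F)
  have : MulAction.IsPretransitive (Hollmann.SemiSL F) Ω := ⟨fun α β => by
    obtain ⟨g, hg⟩ := MulAction.exists_smul_eq (PGammaL F) α β
    obtain ⟨s, rfl⟩ := Hollmann.toPGammaL_surjective g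
    exact ⟨s, hg⟩⟩
  have hΩ' : 2 * Nat.card Ω = Nat.card F * (Nat.card F - 1) := by
    rw [hΩ, hF]
    exact Nat.mul_div_cancel' (dvd_mul_of_dvd_left (dvd_pow_self 2 (by omega)) _)
  obtain ⟨ι, hι, hsmul⟩ := Hollmann.exists_equivariant_bijection hd hd3 hF hΩ'
  have hnt : Nontrivial Ω := by
    rw [← Finite.one_lt_card_iff_nontrivial]
    have h8 : 2 ^ 3 ≤ Nat.card F := by
      rw [hF]
      exact Nat.pow_le_pow_right two_pos hd3
    have h1 : 8 * 7 ≤ Nat.card F * (Nat.card F - 1) := Nat.mul_le_mul (by omega) (by omega)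
    omega
  refine ⟨Hollmann.exists_fusion hι hsmul hd hd3 hF, ?_,
    Hollmann.small_maxInterNum_le hι hsmul hF⟩
  rw [← hF]
  exact Hollmann.small_isPseudocyclic hι hsmul hd hd3 hF
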